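/- Let $S$ be a connected Riemann surface, $e\in S$, and let $\Psi: S\setminus\{e\}\to\widehat{\mathbb C}$ be a meromorphic function with an essential singularity at $e$ (that is, $\Psi$ does not extend meromorphically to $e$). Write $D(a,\rho)\subset\widehat{\mathbb C}$ for the open disk of centre $a$ and radius $\rho$ in the spherical metric. Let $a\in\widehat{\mathbb C}$, and let $U_a$ be a choice, for every $\rho>0$, of a connected component $U_a(\rho)\subset S\setminus\{e\}$ of $\Psi^{-1}(D(a,\rho))$ such that $U_a(\rho_1)\subset U_a(\rho_2)$ whenever $\rho_1<\rho_2$. The choice $U_a$ is called * an *algebraic singularity* of $\Psi^{-1}$ if $\bigcap_{\rho>0}U_a(\rho)=\{z_0\}$ for a critical point $z_0$ of $\Psi$ (that is, $\Psi(z_0)\in\mathbb C$ and $\Psi'(z_0)=0$, or $z_0$ is a multiple pole of $\Psi$); * a *transcendental singularity* of $\Psi^{-1}$ if $\bigcap_{\rho>0}U_a(\rho)=\varnothing$; * a *logarithmic singularity* if it is a transcendental singularity and for some $\rho>0$ the map $\Psi: U_a(\rho)\to D(a,\rho)\setminus\{a\}$ is a universal covering. A *singularity* of $\Psi^{-1}$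 is an algebraic or a transcendental one. A singularity $U_a$ is called *separate* if there is $\rho_1>0$ such that for every other singularity $U_b$ of $\Psi^{-1}$ (over any $b\in\widehat{\mathbb C}$, possibly $b=a$) there is $\rho_2>0$ with $U_a(\rho_1)\cap U_b(\rho_2)=\varnothing$. Let $U_a$ be a singularity of $\Psi^{-1}$ which, if it is transcendental, lies at $e$, in the sense that $e$ belongs to the closure of $U_a(\rho)$ for every $\rho>0$. Then $U_a$ is separate if and only if it is algebraic or logarithmic. -/

import Mathlib

open Set Filter Topology
open scoped Manifold

noncomputable section

/-- The spherical (geodesic) distance on the Riemann sphere `OnePoint ℂ`, realised as the unit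
sphere by stereographic projection: `2 arcsin` of half of the chordal distance. -/
def sphericalDist : OnePoint ℂ → OnePoint ℂ → ℝ
  | .some z, .some w =>
      2 * Real.arcsin (‖z - w‖ / (Real.sqrt (1 + ‖z‖ ^ 2) * Real.sqrt (1 + ‖w‖ ^ 2)))
  | .some z, .infty => 2 * Real.arcsin (1 / Real.sqrt (1 + ‖z‖ ^ 2))
  | .infty, .some w => 2 * Real.arcsin (1 / Real.sqrt (1 + ‖w‖ ^ 2))
  | .infty, .infty => 0

/-- The open disk of radius `ρ` centred at `a` in the spherical metric. -/
def sphericalDisk (a : OnePoint ℂ) (ρ : ℝ) : Set (OnePoint ℂ) :=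
  {t | sphericalDist t a < ρ}

/-- The chart at infinity of the Riemann sphere: `0 ↦ ∞` and `w ↦ 1 / w` for `w ≠ 0`. -/
def sphereInv (w : ℂ) : OnePoint ℂ :=
  open scoped Classical in if w = 0 then OnePoint.infty else ((w⁻¹ : ℂ) : OnePoint ℂ)

section

variable {S : Type*} [TopologicalSpace S] [ChartedSpace ℂ S]

/-- `Ψ` is holomorphic near `p` as a map to the Riemann sphere, that is, a meromorphic function
near `p`: in one of the two standard charts of the sphere it is a holomorphic function. -/
def MeromorphicNear (Ψ : S → OnePoint ℂ) (p : S) : Prop :=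
  ∃ g : S → ℂ, (∀ᶠ z in 𝓝 p, MDifferentiableAt 𝓘(ℂ) 𝓘(ℂ) g z) ∧
    ((∀ᶠ z in 𝓝 p, Ψ z = (g z : OnePoint ℂ)) ∨ (∀ᶠ z in 𝓝 p, Ψ z = sphereInv (g z)))

/-- `p` is a critical point of `Ψ`: either `Ψ` is finite at `p` with `Ψ' (p) = 0`, or `p` is a
multiple pole of `Ψ`, that is, `1 / Ψ` vanishes at `p` together with its derivative. -/
def IsCriticalPt (Ψ : S → OnePoint ℂ) (p : S) : Prop :=
  ∃ g : S → ℂ, (∀ᶠ z in 𝓝 p, MDifferentiableAt 𝓘(ℂ) 𝓘(ℂ) g z) ∧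
    mfderiv 𝓘(ℂ) 𝓘(ℂ) g p = 0 ∧
    ((∀ᶠ z in 𝓝 p, Ψ z = (g z : OnePoint ℂ)) ∨
      (g p = 0 ∧ ∀ᶠ z in 𝓝 p, Ψ z = sphereInv (g z)))

/-- `Ψ` is meromorphic on the surface `S` punctured at `e` and has an essential singularity at `e`:
no choice of a value at `e` makes it meromorphic there. The value `Ψ e` is irrelevant. -/
structure IsTranscendentalMeromorphic (e : S) (Ψ : S → OnePoint ℂ) : Prop where
  meromorphic : ∀ p : S, p ≠ e → MeromorphicNear Ψ p
  essential : ∀ Φ : S → OnePoint ℂ, (∀ p : S, p ≠ e → Φ p = Ψ p) → ¬ MeromorphicNear Φ e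

/-- The preimage of the spherical disk `D (a, ρ)` under `Ψ : S \ {e} → OnePoint ℂ`. -/
def diskPreimage (e : S) (Ψ : S → OnePoint ℂ) (a : OnePoint ℂ) (ρ : ℝ) : Set S :=
  {z | z ≠ e ∧ Ψ z ∈ sphericalDisk a ρ}

/-- A choice `ρ ↦ U (ρ)`, for `ρ > 0`, of a connected component of `Ψ⁻¹ (D (a, ρ))` in `S \ {e}`
that is monotone in `ρ`. -/
@[ext]
structure InverseGerm (e : S) (Ψ : S → OnePoint ℂ) where
  /-- The point `a` of the sphere over which the germ lies. -/
  base : OnePoint ℂ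
  /-- The component `U (ρ)`. -/
  nhd : Ioi (0 : ℝ) → Set S
  isComponent : ∀ ρ : Ioi (0 : ℝ), ∃ z ∈ diskPreimage e Ψ base ρ,
    nhd ρ = connectedComponentIn (diskPreimage e Ψ base ρ) z
  mono : ∀ ρ₁ ρ₂ : Ioi (0 : ℝ), ρ₁ < ρ₂ → nhd ρ₁ ⊆ nhd ρ₂

namespace InverseGerm

variable {e : S} {Ψ : S → OnePoint ℂ}

/-- The neighbourhoods shrink to a critical point of `Ψ`. -/
def IsAlgebraic (U : InverseGerm e Ψ) : Prop :=
  ∃ z₀ : S, ⋂ ρ, U.nhd ρ = {z₀} ∧ IsCriticalPt Ψ z₀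

/-- The neighbourhoods have empty intersection. -/
def IsTranscendental (U : InverseGerm e Ψ) : Prop :=
  ⋂ ρ, U.nhd ρ = ∅

/-- The singularities of the inverse of `Ψ`; what is excluded are the ordinary points. -/
def IsSingularity (U : InverseGerm e Ψ) : Prop :=
  U.IsAlgebraic ∨ U.IsTranscendental

/-- The neighbourhoods accumulate at the essential singularity `e`. -/
def AccumulatesAtEssential (U : InverseGerm e Ψ) : Prop :=
  ∀ ρ, e ∈ closure (U.nhd ρ)

/-- A transcendental singularity is logarithmic if, for some `ρ > 0`, the restriction
`Ψ : U (ρ) → D (a, ρ) \ {a}` is a universal covering. -/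
def IsLogarithmic (U : InverseGerm e Ψ) : Prop :=
  U.IsTranscendental ∧
    ∃ (ρ : Ioi (0 : ℝ)) (h : MapsTo Ψ (U.nhd ρ) (sphericalDisk U.base ρ \ {U.base})),
      IsCoveringMap h.restrict ∧ SimplyConnectedSpace (U.nhd ρ)

/-- Some neighbourhood `U (ρ₁)` is disjoint from a neighbourhood of every other singularity.
The radius `ρ₁` does not depend on the other singularity. -/
def IsSeparate (U : InverseGerm e Ψ) : Prop :=
  ∃ ρ₁, ∀ V : InverseGerm e Ψ, V.IsSingularity → V ≠ U →
    ∃ ρ₂, Disjoint (U.nhd ρ₁) (V.nhd ρ₂)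

end InverseGerm

end

end

/-
The neighbourhoods `U ρ` of an algebraic singularity shrink to a point `z`, near which no other
point is critical. By compactness a germ that meets a small `U ρ` at all scales contains a point
near `z` at all scales; if it is a singularity, this point is critical, so it is `z`, and the germ
is `U`.

Let `U` be transcendental over `a` and separate. For small `ρ` no other singularity meets `U ρ`.
Then `Ψ` is a local homeomorphism on `U ρ`, and paths in the punctured disk lift to `U ρ`: where a
lift breaks off, its tails lie in a germ over the limit value, and that germ is not a singularity.
Hence the exponential, in a coordinate centred at `a`, lifts to a map `F` from a half-plane onto the
points of `U ρ` over the punctured disk, and these turn out to be all of `U ρ`. If `F` were not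
injective it would be periodic, and the circles `dist (Ψ x, a) = r` in `U ρ` would be compact, so
they would stay away from `e`; a punctured neighbourhood of `e` would then lie in `U r`, and `Ψ`
would be bounded near `e` in a coordinate of the sphere, against the essential singularity. So `F`
is a homeomorphism and `U` is logarithmic.

Conversely let `Ψ` be a covering of the punctured disk on `U ρ`. Lifting paths shows that the points
of `U ρ` over a smaller punctured disk about `a` are connected, so a germ over `a` that meets `U ρ`
at all scales is `U` itself. A germ over `b ≠ a` that does so follows one sheet of the covering and
is therefore an ordinary point.
-/

noncomputable section

open scoped ComplexConjugate MatrixGroups unitInterval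

section Moebius

open Matrix (GeneralLinearGroup)

section NormedField

variable {K : Type*} [NormedField K] [DecidableEq K]

lemma continuousAt_glSmul_coe (g : GL (Fin 2) K) {z : K}
    (hz : g • (z : OnePoint K) ≠ OnePoint.infty) :
    ContinuousAt (fun t : OnePoint K ↦ g • t) z := by
  have hden : g 1 0 * z + g 1 1 ≠ 0 := fun h ↦ hz (by rw [OnePoint.smul_some_eq_ite, if_pos h])
  have hquot : ContinuousAt (fun w ↦ (g 0 0 * w + g 0 1) / (g 1 0 * w + g 1 1)) z :=
    ContinuousAt.div (by fun_prop) (by fun_prop) hden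
  rw [OnePoint.continuousAt_coe]
  refine (OnePoint.continuous_coe.continuousAt.comp hquot).congr ?_
  have hcont : Continuous fun w : K ↦ g 1 0 * w + g 1 1 := by fun_prop
  filter_upwards [hcont.continuousAt.eventually_ne hden] with w hw
  rw [Function.comp_apply, Function.comp_apply, OnePoint.smul_some_eq_ite, if_neg hw]

/-- The matrix of the Möbius transformation `z ↦ 1 / z`. -/
def inversion (K : Type*) [Field K] : GL (Fin 2) K :=
  GeneralLinearGroup.mkOfDetNeZero !![0, 1; 1, 0] (by simp)

lemma inversion_smul_infty : inversion K • OnePoint.infty = ((0 : K) : OnePoint K) := by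
  simp [inversion, OnePoint.smul_infty_eq_ite, GeneralLinearGroup.mkOfDetNeZero]

lemma inversion_smul_coe (z : K) : inversion K • (z : OnePoint K) =
    if z = 0 then OnePoint.infty else ((z⁻¹ : K) : OnePoint K) := by
  simp [inversion, OnePoint.smul_some_eq_ite, GeneralLinearGroup.mkOfDetNeZero]

lemma inversion_smul_inversion_smul (t : OnePoint K) : inversion K • inversion K • t = t := by
  induction t using OnePoint.rec with
  | infty => simp [inversion_smul_infty, inversion_smul_coe]
  | coe z =>
    by_cases hz : z = 0
    · simp [hz, inversion_smul_infty, inversion_smul_coe]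
    · simp [hz, inversion_smul_coe]

variable [ProperSpace K]

lemma continuous_inversion_smul : Continuous fun t : OnePoint K ↦ inversion K • t := by
  refine continuous_iff_continuousAt.2 fun t ↦ ?_
  induction t using OnePoint.rec with
  | infty =>
    rw [OnePoint.continuousAt_infty', inversion_smul_infty, coclosedCompact_eq_cocompact,
      ← Metric.cobounded_eq_cocompact]
    refine ((OnePoint.continuous_coe.tendsto 0).comp tendsto_inv₀_cobounded).congr' ?_
    filter_upwards [Bornology.eventually_ne_cobounded 0] with z hz
    simp [inversion_smul_coe, hz]
  | coe z =>
    by_cases hz : z = 0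
    · subst hz
      have hinv : Tendsto (fun w : K ↦ w⁻¹) (𝓝[≠] 0) (coclosedCompact K) := by
        rw [coclosedCompact_eq_cocompact, ← Metric.cobounded_eq_cocompact]
        exact tendsto_inv₀_nhdsNE_zero
      rw [OnePoint.continuousAt_coe, continuousAt_iff_punctured_nhds, Function.comp_apply,
        inversion_smul_coe, if_pos rfl]
      refine (OnePoint.tendsto_coe_infty.comp hinv).congr' ?_
      filter_upwards [self_mem_nhdsWithin] with w (hw : w ≠ 0)
      rw [Function.comp_apply, Function.comp_apply, inversion_smul_coe, if_neg hw]
    · exact continuousAt_glSmul_coe _ (by simp [inversion_smul_coe, hz])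

lemma continuous_glSmul (g : GL (Fin 2) K) : Continuous fun t : OnePoint K ↦ g • t := by
  have continuousAt_coe (h : GL (Fin 2) K) (z : K) :
      ContinuousAt (fun t : OnePoint K ↦ h • t) z := by
    by_cases hz : h • (z : OnePoint K) = OnePoint.infty
    · have hfin : (inversion K * h) • (z : OnePoint K) ≠ OnePoint.infty := by
        simp [mul_smul, hz, inversion_smul_infty]
      refine (continuous_inversion_smul.continuousAt.comp
        (continuousAt_glSmul_coe _ hfin)).congr (.of_forall fun t ↦ ?_)
      simp [mul_smul, inversion_smul_inversion_smul]
    · exact continuousAt_glSmul_coe _ hz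
  refine continuous_iff_continuousAt.2 fun t ↦ ?_
  induction t using OnePoint.rec with
  | infty =>
    have hcomp : ContinuousAt (fun t : OnePoint K ↦ (g * inversion K) • inversion K • t)
        OnePoint.infty := by
      refine ContinuousAt.comp (g := fun t : OnePoint K ↦ (g * inversion K) • t) ?_
        continuous_inversion_smul.continuousAt
      rw [inversion_smul_infty]
      exact continuousAt_coe _ 0
    simpa only [mul_smul, inversion_smul_inversion_smul] using hcomp
  | coe z => exact continuousAt_coe g z

/-- A Möbius transformation of the projective line, as a homeomorphism. -/
def glHomeomorph (g : GL (Fin 2) K) : OnePoint K ≃ₜ OnePoint K where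
  toEquiv := MulAction.toPerm g
  continuous_toFun := continuous_glSmul g
  continuous_invFun := continuous_glSmul g⁻¹

end NormedField

lemma exists_analyticAt_glSmul_eq {g : GL (Fin 2) ℂ} {z z' : ℂ}
    (h : g • (z : OnePoint ℂ) = z') :
    ∃ m : ℂ → ℂ, AnalyticAt ℂ m z ∧ m z = z' ∧
      ∀ᶠ w : ℂ in 𝓝 z, g • (w : OnePoint ℂ) = m w := by
  have hden : g 1 0 * z + g 1 1 ≠ 0 := fun h0 ↦ by simp [OnePoint.smul_some_eq_ite, h0] at h
  rw [OnePoint.smul_some_eq_ite, if_neg hden] at h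
  refine ⟨fun w ↦ (g 0 0 * w + g 0 1) / (g 1 0 * w + g 1 1),
    AnalyticAt.div (by fun_prop) (by fun_prop) hden, OnePoint.coe_injective h, ?_⟩
  have hcont : Continuous fun w : ℂ ↦ g 1 0 * w + g 1 1 := by fun_prop
  filter_upwards [hcont.continuousAt.eventually_ne hden] with w hw
  rw [OnePoint.smul_some_eq_ite, if_neg hw]

lemma one_add_mul_conj_ne_zero (z : ℂ) : 1 + z * conj z ≠ 0 := by
  rw [Complex.mul_conj]
  exact_mod_cast (add_pos_of_pos_of_nonneg one_pos (Complex.normSq_nonneg z)).ne'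

/-- A matrix whose Möbius transformation is a rotation of the Riemann sphere that moves `0`
to `a`. -/
def centering : OnePoint ℂ → GL (Fin 2) ℂ
  | .some z => GeneralLinearGroup.mkOfDetNeZero !![1, z; -conj z, 1]
      (by simpa [Matrix.det_fin_two] using one_add_mul_conj_ne_zero z)
  | .infty => inversion ℂ

lemma centering_coe_smul_coe (z w : ℂ) : centering z • (w : OnePoint ℂ) =
    if 1 - conj z * w = 0 then OnePoint.infty
    else (((w + z) / (1 - conj z * w) : ℂ) : OnePoint ℂ) := by
  change GeneralLinearGroup.mkOfDetNeZero _ _ • (w : OnePoint ℂ) = _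
  simp [OnePoint.smul_some_eq_ite, GeneralLinearGroup.mkOfDetNeZero, sub_eq_add_neg, add_comm]

lemma centering_coe_smul_infty (z : ℂ) : centering z • OnePoint.infty =
    if z = 0 then OnePoint.infty else ((-(conj z)⁻¹ : ℂ) : OnePoint ℂ) := by
  change GeneralLinearGroup.mkOfDetNeZero _ _ • OnePoint.infty = _
  simp [OnePoint.smul_infty_eq_ite, GeneralLinearGroup.mkOfDetNeZero]

/-- The inverse of the holomorphic coordinate on the Riemann sphere obtained from the standard one
by a rotation that moves `0` to `a`. -/
def centeredPt (a : OnePoint ℂ) (w : ℂ) : OnePoint ℂ := centering a • (w : OnePoint ℂ)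

lemma isOpenEmbedding_centeredPt (a : OnePoint ℂ) : IsOpenEmbedding (centeredPt a) :=
  (glHomeomorph (centering a)).isOpenEmbedding.comp OnePoint.isOpenEmbedding_coe

lemma continuous_centeredPt (a : OnePoint ℂ) : Continuous (centeredPt a) :=
  (isOpenEmbedding_centeredPt a).continuous

lemma centeredPt_injective (a : OnePoint ℂ) : Function.Injective (centeredPt a) :=
  (isOpenEmbedding_centeredPt a).injective

lemma centeredPt_infty (w : ℂ) : centeredPt OnePoint.infty w = sphereInv w :=
  (inversion_smul_coe w).trans (by simp [sphereInv])

lemma centeredPt_zero_eq_coe (w : ℂ) : centeredPt ((0 : ℂ) : OnePoint ℂ) w = w := by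
  simp [centeredPt, centering_coe_smul_coe]

@[simp] lemma centeredPt_zero (a : OnePoint ℂ) : centeredPt a 0 = a := by
  induction a using OnePoint.rec with
  | infty => simp [centeredPt_infty, sphereInv]
  | coe z => simp [centeredPt, centering_coe_smul_coe]

lemma exists_analyticAt_centeredPt_eq {a b : OnePoint ℂ} {z z' : ℂ}
    (h : centeredPt a z = centeredPt b z') :
    ∃ m : ℂ → ℂ, AnalyticAt ℂ m z ∧ m z = z' ∧
      ∀ᶠ w in 𝓝 z, centeredPt a w = centeredPt b (m w) := by
  have hg : ((centering b)⁻¹ * centering a) • (z : OnePoint ℂ) = z' := by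
    rw [mul_smul, inv_smul_eq_iff]
    exact h
  obtain ⟨m, hm, hmz, hmeq⟩ := exists_analyticAt_glSmul_eq hg
  refine ⟨m, hm, hmz, hmeq.mono fun w hw ↦ ?_⟩
  rwa [mul_smul, inv_smul_eq_iff] at hw

lemma eq_centering_smul_infty {a t : OnePoint ℂ} (ht : t ∉ range (centeredPt a)) :
    t = centering a • OnePoint.infty := by
  rw [← inv_smul_eq_iff]
  by_contra h
  obtain ⟨w, hw⟩ := OnePoint.ne_infty_iff_exists.1 h
  exact ht ⟨w, by rw [centeredPt, hw, smul_inv_smul]⟩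

end Moebius

section SphericalDist

lemma one_add_norm_div_sq {v : ℂ} (hv : v ≠ 0) (u : ℂ) :
    1 + ‖u / v‖ ^ 2 = (‖v‖ ^ 2 + ‖u‖ ^ 2) / ‖v‖ ^ 2 := by
  have : ‖v‖ ≠ 0 := norm_ne_zero_iff.2 hv
  rw [norm_div]
  field_simp

lemma norm_sq_one_sub_conj_mul_add (z w : ℂ) :
    ‖1 - conj z * w‖ ^ 2 + ‖w + z‖ ^ 2 = (1 + ‖z‖ ^ 2) * (1 + ‖w‖ ^ 2) := by
  simp only [← Complex.normSq_eq_norm_sq, Complex.normSq_apply, Complex.add_re, Complex.mul_re,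
    Complex.add_im, Complex.mul_im, Complex.sub_re, Complex.sub_im, Complex.conj_re,
    Complex.conj_im, Complex.one_re, Complex.one_im]
  ring

lemma norm_one_add_mul_conj (z : ℂ) : ‖1 + z * conj z‖ = 1 + ‖z‖ ^ 2 := by
  rw [Complex.mul_conj', ← Complex.ofReal_pow, ← Complex.ofReal_one, ← Complex.ofReal_add,
    Complex.norm_real, Real.norm_of_nonneg (by positivity)]

lemma sphericalDist_coe_coe (z w : ℂ) : sphericalDist z w =
    2 * Real.arcsin (‖z - w‖ / (√(1 + ‖z‖ ^ 2) * √(1 + ‖w‖ ^ 2))) := rfl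

lemma sphericalDist_coe_infty (z : ℂ) :
    sphericalDist z OnePoint.infty = 2 * Real.arcsin (1 / √(1 + ‖z‖ ^ 2)) := rfl

lemma sphericalDist_infty_coe (w : ℂ) :
    sphericalDist OnePoint.infty w = 2 * Real.arcsin (1 / √(1 + ‖w‖ ^ 2)) := rfl

lemma sphericalDist_sphereInv_infty (w : ℂ) :
    sphericalDist (sphereInv w) OnePoint.infty = 2 * Real.arctan ‖w‖ := by
  by_cases hw : w = 0
  · simp [hw, sphereInv, sphericalDist]
  · have hw' : 0 < ‖w‖ := norm_pos_iff.2 hw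
    rw [sphereInv, if_neg hw, sphericalDist_coe_infty, inv_eq_one_div, one_add_norm_div_sq hw,
      Real.arctan_eq_arcsin, Real.sqrt_div (by positivity), Real.sqrt_sq hw'.le, norm_one,
      one_pow, one_div_div, add_comm]

lemma sphericalDist_centering_coe_smul (z w : ℂ) :
    sphericalDist (centering z • (w : OnePoint ℂ)) z = 2 * Real.arctan ‖w‖ := by
  have hsq := norm_sq_one_sub_conj_mul_add z w
  rw [centering_coe_smul_coe, Real.arctan_eq_arcsin]
  split_ifs with hden
  · have hzw : conj z * w = 1 := (sub_eq_zero.1 hden).symm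
    have hnorm : ‖z‖ * ‖w‖ = 1 := by rw [← Complex.norm_conj z, ← norm_mul, hzw, norm_one]
    have hw : 0 < ‖w‖ := by
      refine norm_pos_iff.2 fun h ↦ ?_
      simp [h] at hzw
    have hone : 1 + ‖w‖ ^ 2 = ‖w‖ ^ 2 * (1 + ‖z‖ ^ 2) := by
      linear_combination (-(‖z‖ * ‖w‖) - 1) * hnorm
    rw [sphericalDist_infty_coe, hone, Real.sqrt_mul (by positivity), Real.sqrt_sq hw.le]
    field_simp
  · have hden' : 0 < ‖1 - conj z * w‖ := norm_pos_iff.2 hden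
    have hdiff : (w + z) / (1 - conj z * w) - z = w * (1 + z * conj z) / (1 - conj z * w) := by
      rw [div_sub' hden]
      ring
    rw [sphericalDist_coe_coe, one_add_norm_div_sq hden, hsq, hdiff, norm_div, norm_mul,
      norm_one_add_mul_conj, Real.sqrt_div (by positivity), Real.sqrt_mul (by positivity),
      Real.sqrt_sq hden'.le]
    congr 2
    have : 0 < √(1 + ‖z‖ ^ 2) := by positivity
    have : 0 < √(1 + ‖w‖ ^ 2) := by positivity
    field_simp
    rw [Real.sq_sqrt (by positivity)]

lemma sphericalDist_centeredPt (a : OnePoint ℂ) (w : ℂ) :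
    sphericalDist (centeredPt a w) a = 2 * Real.arctan ‖w‖ := by
  induction a using OnePoint.rec with
  | infty => rw [centeredPt_infty, sphericalDist_sphereInv_infty]
  | coe z => exact sphericalDist_centering_coe_smul z w

lemma sphericalDist_centering_smul_infty (a : OnePoint ℂ) :
    sphericalDist (centering a • OnePoint.infty) a = Real.pi := by
  suffices h : ∃ x : ℝ, sphericalDist (centering a • OnePoint.infty) a = 2 * Real.arcsin x ∧
      x = 1 by
    obtain ⟨x, hx, rfl⟩ := h
    rw [hx, Real.arcsin_one]
    ring
  induction a using OnePoint.rec with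
  | infty =>
    refine ⟨_, (congrArg (sphericalDist · OnePoint.infty) inversion_smul_infty).trans
      (sphericalDist_coe_infty 0), by simp⟩
  | coe z =>
    rw [centering_coe_smul_infty]
    split_ifs with hz
    · exact ⟨_, sphericalDist_infty_coe z, by simp [hz]⟩
    · have hz' : 0 < ‖z‖ := norm_pos_iff.2 hz
      have hconj : conj z ≠ 0 := by simpa using hz
      have hsub : -(conj z)⁻¹ - z = -((1 + z * conj z) / conj z) := by
        field_simp
        ring
      refine ⟨_, sphericalDist_coe_coe _ z, ?_⟩
      rw [hsub, norm_neg, norm_neg, inv_eq_one_div, one_add_norm_div_sq hconj, norm_div,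
        norm_one_add_mul_conj, Complex.norm_conj, norm_one, one_pow, add_comm (‖z‖ ^ 2),
        Real.sqrt_div (by positivity), Real.sqrt_sq hz'.le, div_mul_eq_mul_div,
        Real.mul_self_sqrt (by positivity), div_self (by positivity)]

lemma sphericalDist_of_notMem_range_centeredPt {a t : OnePoint ℂ}
    (ht : t ∉ range (centeredPt a)) : sphericalDist t a = Real.pi := by
  rw [eq_centering_smul_infty ht, sphericalDist_centering_smul_infty]

end SphericalDist

section SphericalDisk

lemma continuous_sphericalDist_left (a : OnePoint ℂ) : Continuous (sphericalDist · a) := by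
  rw [← (glHomeomorph (centering a)).comp_continuous_iff', OnePoint.continuous_iff]
  change Tendsto (fun w ↦ sphericalDist (centeredPt a w) a) _
    (𝓝 (sphericalDist (centering a • OnePoint.infty) a)) ∧
    Continuous fun w ↦ sphericalDist (centeredPt a w) a
  simp only [sphericalDist_centeredPt, sphericalDist_centering_smul_infty]
  constructor
  · rw [coclosedCompact_eq_cocompact, ← mul_div_cancel₀ Real.pi two_ne_zero]
    exact ((tendsto_nhds_of_tendsto_nhdsWithin Real.tendsto_arctan_atTop).comp
      tendsto_norm_cocompact_atTop).const_mul 2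
  · exact (Real.continuous_arctan.comp continuous_norm).const_mul 2

lemma sphericalDist_pos {a t : OnePoint ℂ} (h : t ≠ a) : 0 < sphericalDist t a := by
  by_cases ht : t ∈ range (centeredPt a)
  · obtain ⟨w, rfl⟩ := ht
    have hw : w ≠ 0 := fun hw ↦ h (by simp [hw])
    rw [sphericalDist_centeredPt]
    exact mul_pos two_pos (Real.arctan_pos.2 (norm_pos_iff.2 hw))
  · rw [sphericalDist_of_notMem_range_centeredPt ht]
    exact Real.pi_pos

lemma centeredPt_mem_sphericalDisk {a : OnePoint ℂ} {w : ℂ} {ρ : ℝ} :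
    centeredPt a w ∈ sphericalDisk a ρ ↔ 2 * Real.arctan ‖w‖ < ρ := by
  simp [sphericalDisk, sphericalDist_centeredPt]

lemma center_mem_sphericalDisk (a : OnePoint ℂ) {ρ : ℝ} (hρ : 0 < ρ) : a ∈ sphericalDisk a ρ := by
  have h := centeredPt_mem_sphericalDisk (a := a) (w := 0) (ρ := ρ)
  simpa [hρ] using h

lemma sphericalDisk_mono (a : OnePoint ℂ) {ρ₁ ρ₂ : ℝ} (h : ρ₁ ≤ ρ₂) :
    sphericalDisk a ρ₁ ⊆ sphericalDisk a ρ₂ := fun _ ht ↦ lt_of_lt_of_le ht h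

lemma eq_of_forall_mem_sphericalDisk {a t : OnePoint ℂ}
    (h : ∀ ρ : Ioi (0 : ℝ), t ∈ sphericalDisk a ρ) : t = a := by
  by_contra hne
  exact lt_irrefl (sphericalDist t a) (h ⟨_, sphericalDist_pos hne⟩)

lemma sphericalDisk_subset_range {a : OnePoint ℂ} {ρ : ℝ} (hρ : ρ ≤ Real.pi) :
    sphericalDisk a ρ ⊆ range (centeredPt a) := by
  intro t (ht : sphericalDist t a < ρ)
  by_contra h
  exact (ht.trans_le hρ).ne (sphericalDist_of_notMem_range_centeredPt h)

lemma two_mul_arctan_lt_iff {x ρ : ℝ} (hρ : 0 < ρ) (hρ' : ρ < Real.pi) :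
    2 * Real.arctan x < ρ ↔ x < Real.tan (ρ / 2) := by
  have harctan : Real.arctan (Real.tan (ρ / 2)) = ρ / 2 :=
    Real.arctan_tan (by linarith) (by linarith)
  rw [← Real.arctan_strictMono.lt_iff_lt (a := x), harctan, lt_div_iff₀' two_pos]

lemma tan_half_pos {ρ : ℝ} (hρ : 0 < ρ) (hρ' : ρ < Real.pi) : 0 < Real.tan (ρ / 2) :=
  Real.tan_pos_of_pos_of_lt_pi_div_two (by linarith) (by linarith)

lemma centeredPt_mem_sphericalDisk_iff_mem_ball {a : OnePoint ℂ} {w : ℂ} {ρ : ℝ} (hρ : 0 < ρ)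
    (hρ' : ρ < Real.pi) :
    centeredPt a w ∈ sphericalDisk a ρ ↔ w ∈ Metric.ball 0 (Real.tan (ρ / 2)) := by
  rw [centeredPt_mem_sphericalDisk, two_mul_arctan_lt_iff hρ hρ', mem_ball_zero_iff]

lemma sphericalDisk_eq_image {a : OnePoint ℂ} {ρ : ℝ} (hρ : 0 < ρ) (hρ' : ρ < Real.pi) :
    sphericalDisk a ρ = centeredPt a '' Metric.ball 0 (Real.tan (ρ / 2)) := by
  ext t
  constructor
  · intro ht
    obtain ⟨w, rfl⟩ := sphericalDisk_subset_range hρ'.le ht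
    exact ⟨w, (centeredPt_mem_sphericalDisk_iff_mem_ball hρ hρ').1 ht, rfl⟩
  · rintro ⟨w, hw, rfl⟩
    exact (centeredPt_mem_sphericalDisk_iff_mem_ball hρ hρ').2 hw

lemma isPreconnected_sphericalDisk {a : OnePoint ℂ} {ρ : ℝ} (hρ : 0 < ρ) (hρ' : ρ < Real.pi) :
    IsPreconnected (sphericalDisk a ρ) := by
  rw [sphericalDisk_eq_image hρ hρ']
  exact Metric.isPreconnected_ball.image _ (continuous_centeredPt a).continuousOn

lemma isOpen_sphericalDisk (a : OnePoint ℂ) (ρ : ℝ) : IsOpen (sphericalDisk a ρ) :=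
  isOpen_lt (continuous_sphericalDist_left a) continuous_const

lemma isClosed_sphericalDist_le (a : OnePoint ℂ) (r : ℝ) : IsClosed {t | sphericalDist t a ≤ r} :=
  isClosed_le (continuous_sphericalDist_left a) continuous_const

lemma sphericalDisk_mem_nhds (a : OnePoint ℂ) {ρ : ℝ} (hρ : 0 < ρ) :
    sphericalDisk a ρ ∈ 𝓝 a :=
  (isOpen_sphericalDisk a ρ).mem_nhds (center_mem_sphericalDisk a hρ)

lemma exists_sphericalDisk_subset {a : OnePoint ℂ} {N : Set (OnePoint ℂ)} (hN : N ∈ 𝓝 a) :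
    ∃ ρ, 0 < ρ ∧ ρ < Real.pi ∧ sphericalDisk a ρ ⊆ N := by
  have hpre : centeredPt a ⁻¹' N ∈ 𝓝 (0 : ℂ) :=
    (continuous_centeredPt a).continuousAt.preimage_mem_nhds (by simpa using hN)
  obtain ⟨ε, hε, hεN⟩ := Metric.mem_nhds_iff.1 hpre
  have hpos : 0 < Real.arctan ε := Real.arctan_pos.2 hε
  have hlt : Real.arctan ε < Real.pi / 2 := Real.arctan_lt_pi_div_two ε
  refine ⟨2 * Real.arctan ε, by linarith, by linarith, ?_⟩
  rw [sphericalDisk_eq_image (by linarith) (by linarith), mul_div_cancel_left₀ _ two_ne_zero,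
    Real.tan_arctan]
  exact image_subset_iff.2 hεN

end SphericalDisk

section InjectiveNear

variable {X Y Z : Type*} [TopologicalSpace X]

/-- `f` is injective on a neighbourhood of `x`. -/
def InjectiveNear (f : X → Y) (x : X) : Prop := ∃ N ∈ 𝓝 x, InjOn f N

lemma injectiveNear_congr {f g : X → Y} {x : X} (h : f =ᶠ[𝓝 x] g) :
    InjectiveNear f x ↔ InjectiveNear g x := by
  suffices himp : ∀ {f g : X → Y}, f =ᶠ[𝓝 x] g → InjectiveNear f x → InjectiveNear g x from
    ⟨himp h, himp h.symm⟩
  rintro f g h ⟨N, hN, hinj⟩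
  exact ⟨N ∩ {y | f y = g y}, inter_mem hN h,
    (hinj.mono inter_subset_left).congr fun _ hy ↦ hy.2⟩

lemma injectiveNear_comp_left_iff {g : Y → Z} (hg : Function.Injective g) {f : X → Y} {x : X} :
    InjectiveNear (g ∘ f) x ↔ InjectiveNear f x :=
  exists_congr fun _ ↦ and_congr_right fun _ ↦
    ⟨fun h _ hx _ hy hxy ↦ h hx hy (congrArg g hxy), fun h ↦ hg.comp_injOn h⟩

lemma injectiveNear_comp_openPartialHomeomorph_iff [TopologicalSpace Y]
    (φ : OpenPartialHomeomorph X Y) {f : Y → Z} {x : X} (hx : x ∈ φ.source) :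
    InjectiveNear (f ∘ φ) x ↔ InjectiveNear f (φ x) := by
  constructor
  · rintro ⟨N, hN, hinj⟩
    exact ⟨φ '' N, φ.image_mem_nhds hx hN, hinj.image_of_comp⟩
  · rintro ⟨N, hN, hinj⟩
    exact ⟨φ ⁻¹' N ∩ φ.source, inter_mem ((φ.continuousAt hx).preimage_mem_nhds hN)
      (φ.open_source.mem_nhds hx), hinj.comp (φ.injOn.mono inter_subset_right) fun _ hy ↦ hy.1⟩

lemma InjectiveNear.not_eventually_eq {f : X → Y} {x : X} [(𝓝[≠] x).NeBot]
    (h : InjectiveNear f x) : ¬ ∀ᶠ z in 𝓝 x, f z = f x := by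
  obtain ⟨N, hN, hinj⟩ := h
  intro hconst
  obtain ⟨z, ⟨hz, hzN⟩, hzx⟩ := (((hconst.and hN).filter_mono nhdsWithin_le_nhds).and
    (eventually_mem_nhdsWithin (a := x) (s := {x}ᶜ))).exists
  exact hzx (hinj hzN (mem_of_mem_nhds hN) hz)

end InjectiveNear

section Holomorphic

variable {f : ℂ → ℂ} {z₀ : ℂ}

lemma eventually_deriv_ne_zero_of_analyticAt (hf : AnalyticAt ℂ f z₀)
    (hne : ¬ ∀ᶠ z in 𝓝 z₀, f z = f z₀) : ∀ᶠ z in 𝓝[≠] z₀, deriv f z ≠ 0 := by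
  refine hf.deriv.eventually_eq_zero_or_eventually_ne_zero.resolve_left fun hzero ↦ hne ?_
  obtain ⟨ε, hε, hball⟩ := Metric.eventually_nhds_iff_ball.1 (hzero.and hf.eventually_analyticAt)
  refine Metric.eventually_nhds_iff_ball.2 ⟨ε, hε, fun z hz ↦ ?_⟩
  exact Metric.isOpen_ball.is_const_of_deriv_eq_zero Metric.isPreconnected_ball
    (fun y hy ↦ (hball y hy).2.differentiableAt.differentiableWithinAt)
    (fun y hy ↦ (hball y hy).1) hz (Metric.mem_ball_self hε)

lemma injectiveNear_of_deriv_ne_zero (hf : AnalyticAt ℂ f z₀) (hd : deriv f z₀ ≠ 0) :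
    InjectiveNear f z₀ := by
  have h := hf.hasStrictDerivAt.hasStrictFDerivAt_equiv hd
  exact ⟨_, h.toOpenPartialHomeomorph.open_source.mem_nhds h.mem_toOpenPartialHomeomorph_source,
    h.toOpenPartialHomeomorph.injOn⟩

lemma exists_openPartialHomeomorph_of_injectiveNear (hf : AnalyticAt ℂ f z₀)
    (hinj : InjectiveNear f z₀) :
    ∃ φ : OpenPartialHomeomorph ℂ ℂ, z₀ ∈ φ.source ∧ ⇑φ = f ∧ AnalyticOnNhd ℂ f φ.source := by
  obtain ⟨N, hN, hinj⟩ := hinj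
  obtain ⟨r, hr, hball⟩ := Metric.eventually_nhds_iff_ball.1 (hf.eventually_analyticAt.and hN)
  have hanalytic : AnalyticOnNhd ℂ f (Metric.ball z₀ r) := fun z hz ↦ (hball z hz).1
  have hinjB : InjOn f (Metric.ball z₀ r) := hinj.mono fun z hz ↦ (hball z hz).2
  have hmap : ∀ s ⊆ Metric.ball z₀ r, IsOpen s → IsOpen (f '' s) := by
    refine (hanalytic.is_constant_or_isOpen Metric.isPreconnected_ball).resolve_left ?_
    rintro ⟨c, hc⟩
    refine InjectiveNear.not_eventually_eq ⟨_, Metric.ball_mem_nhds z₀ hr, hinjB⟩ ?_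
    filter_upwards [Metric.ball_mem_nhds z₀ hr] with z hz
    rw [hc z hz, hc z₀ (Metric.mem_ball_self hr)]
  refine ⟨.ofContinuousOpenRestrict hinjB.toPartialEquiv hanalytic.continuousOn (fun s hs ↦ ?_)
    Metric.isOpen_ball, Metric.mem_ball_self hr, rfl, hanalytic⟩
  have h := hmap (Subtype.val '' s) (Subtype.coe_image_subset _ s)
    (Metric.isOpen_ball.isOpenMap_subtype_val s hs)
  rwa [image_image] at h

lemma deriv_ne_zero_of_injectiveNear (hf : AnalyticAt ℂ f z₀) (hinj : InjectiveNear f z₀) :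
    deriv f z₀ ≠ 0 := by
  obtain ⟨φ, hz₀, rfl, hφ⟩ := exists_openPartialHomeomorph_of_injectiveNear hf hinj
  have hw₀ : φ z₀ ∈ φ.target := φ.map_source hz₀
  have hsymm : ContinuousAt φ.symm (φ z₀) := φ.symm.continuousAt hw₀
  have hderiv : ∀ᶠ z in 𝓝 z₀, z ≠ z₀ → deriv φ z ≠ 0 := eventually_nhdsWithin_iff.1
    (eventually_deriv_ne_zero_of_analyticAt hf hinj.not_eventually_eq)
  -- The inverse is differentiable off `φ z₀` and continuous there, so the singularity is removable.
  have hinv : AnalyticAt ℂ φ.symm (φ z₀) := by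
    refine Complex.analyticAt_of_differentiable_on_punctured_nhds_of_continuousAt ?_ hsymm
    rw [← φ.left_inv hz₀] at hderiv
    filter_upwards [eventually_nhdsWithin_of_eventually_nhds (hsymm.eventually hderiv),
      eventually_nhdsWithin_of_eventually_nhds (φ.open_target.mem_nhds hw₀),
      φ.symm.eventually_ne_nhdsWithin hw₀] with w hw hwt hne
    exact (φ.hasDerivAt_symm hwt (hw hne)
      (hφ _ (φ.map_target hwt)).differentiableAt.hasDerivAt).differentiableAt
  have hid : HasDerivAt (φ.symm ∘ φ) 1 z₀ :=
    (hasDerivAt_id z₀).congr_of_eventuallyEq (φ.eventually_left_inverse hz₀)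
  exact right_ne_zero_of_mul_eq_one ((hinv.differentiableAt.hasDerivAt.comp z₀
    hf.differentiableAt.hasDerivAt).unique hid)

lemma injectiveNear_iff_deriv_ne_zero (hf : AnalyticAt ℂ f z₀) :
    InjectiveNear f z₀ ↔ deriv f z₀ ≠ 0 :=
  ⟨deriv_ne_zero_of_injectiveNear hf, injectiveNear_of_deriv_ne_zero hf⟩

lemma ball_diff_singleton_eq_image_exp (z₀ : ℂ) {R : ℝ} (hR : 0 < R) :
    Metric.ball z₀ R \ {z₀} = (fun s ↦ z₀ + Complex.exp s) '' {s | s.re < Real.log R} := by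
  ext z
  constructor
  · rintro ⟨hz, hne⟩
    have hne' : z - z₀ ≠ 0 := sub_ne_zero.2 hne
    refine ⟨Complex.log (z - z₀), ?_, by simp [Complex.exp_log hne']⟩
    rw [mem_ofPred_eq, Complex.log_re]
    exact Real.log_lt_log (norm_pos_iff.2 hne') (by simpa [dist_eq_norm] using hz)
  · rintro ⟨s, hs, rfl⟩
    refine ⟨?_, by simp [Complex.exp_ne_zero]⟩
    simp only [Metric.mem_ball, dist_eq_norm, add_sub_cancel_left, Complex.norm_exp]
    exact (Real.lt_log_iff_exp_lt hR).1 hs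

lemma isPathConnected_ball_diff_singleton (z₀ : ℂ) {R : ℝ} (hR : 0 < R) :
    IsPathConnected (Metric.ball z₀ R \ {z₀}) := by
  rw [ball_diff_singleton_eq_image_exp z₀ hR]
  refine IsPathConnected.image ?_ (by fun_prop)
  refine (convex_halfSpace_re_lt _).isPathConnected ⟨(Real.log R - 1 : ℝ), ?_⟩
  simp

end Holomorphic

section LocalRep

variable {S : Type*} [TopologicalSpace S] {Ψ : S → OnePoint ℂ} {φ : OpenPartialHomeomorph S ℂ}
  {p : S} {b c : OnePoint ℂ} {G : ℂ → ℂ}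

/-- Near `p`, the map `Ψ` to the Riemann sphere is given by the holomorphic function `G` in the
chart `φ` of the source and the coordinate centred at `b` of the sphere. -/
structure IsLocalRep (Ψ : S → OnePoint ℂ) (φ : OpenPartialHomeomorph S ℂ) (p : S)
    (b : OnePoint ℂ) (G : ℂ → ℂ) : Prop where
  mem_source : p ∈ φ.source
  analyticAt : AnalyticAt ℂ G (φ p)
  eventuallyEq : Ψ =ᶠ[𝓝 p] centeredPt b ∘ G ∘ φ

lemma eventually_nhdsNE_openPartialHomeomorph_iff {X Y : Type*} [TopologicalSpace X]
    [TopologicalSpace Y] (φ : OpenPartialHomeomorph X Y) {x : X} (hx : x ∈ φ.source)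
    {P : Y → Prop} : (∀ᶠ y in 𝓝[≠] (φ x), P y) ↔ ∀ᶠ z in 𝓝[≠] x, P (φ z) := by
  rw [eventually_nhdsWithin_iff, eventually_nhdsWithin_iff, φ.eventually_nhds _ hx]
  refine eventually_congr ?_
  filter_upwards [φ.open_source.mem_nhds hx] with z hz
  simp only [mem_compl_singleton_iff, ne_eq, φ.injOn.eq_iff hz hx]

lemma exists_analyticAt_update {f : ℂ → ℂ} {c : ℂ} {R : ℝ}
    (hf : ∀ᶠ z in 𝓝[≠] c, DifferentiableAt ℂ f z) (hR : ∀ᶠ z in 𝓝[≠] c, ‖f z‖ ≤ R) :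
    ∃ w, AnalyticAt ℂ (Function.update f c w) c := by
  have hbdd : IsBoundedUnder (· ≤ ·) (𝓝[≠] c) fun z ↦ ‖f z - f c‖ :=
    isBoundedUnder_of_eventually_le (hR.mono fun z hz ↦
      (norm_sub_le _ _).trans (add_le_add_left hz ‖f c‖))
  have hlim := Complex.tendsto_limUnder_of_differentiable_on_punctured_nhds_of_bounded_under hf hbdd
  refine ⟨_, Complex.analyticAt_of_differentiable_on_punctured_nhds_of_continuousAt ?_
    (continuousAt_update_same.2 hlim)⟩
  filter_upwards [hf, self_mem_nhdsWithin] with z hz hzc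
  refine hz.congr_of_eventuallyEq ?_
  filter_upwards [isOpen_ne.mem_nhds hzc] with v hv using Function.update_of_ne hv _ _

namespace IsLocalRep

lemma apply_eq (h : IsLocalRep Ψ φ p b G) : Ψ p = centeredPt b (G (φ p)) :=
  h.eventuallyEq.self_of_nhds

lemma eventually (h : IsLocalRep Ψ φ p b G) : ∀ᶠ q in 𝓝 p, IsLocalRep Ψ φ q b G := by
  filter_upwards [φ.open_source.mem_nhds h.mem_source, h.eventuallyEq.eventuallyEq_nhds,
    (φ.continuousAt h.mem_source).eventually h.analyticAt.eventually_analyticAt] with q hq heq hG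
  exact ⟨hq, hG, heq⟩

lemma exists_change_center (h : IsLocalRep Ψ φ p b G) {w : ℂ} (hw : Ψ p = centeredPt c w) :
    ∃ G', IsLocalRep Ψ φ p c G' ∧ G' (φ p) = w := by
  obtain ⟨m, hm, hmw, hmeq⟩ := exists_analyticAt_centeredPt_eq (h.apply_eq.symm.trans hw)
  refine ⟨m ∘ G, ⟨h.mem_source, hm.comp h.analyticAt, ?_⟩, hmw⟩
  filter_upwards [h.eventuallyEq, (h.analyticAt.continuousAt.comp
    (φ.continuousAt h.mem_source)).eventually hmeq] with z hz hmz
  exact hz.trans hmz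

lemma continuousAt (h : IsLocalRep Ψ φ p b G) : ContinuousAt Ψ p :=
  ((continuous_centeredPt b).continuousAt.comp
    (h.analyticAt.continuousAt.comp (φ.continuousAt h.mem_source))).congr h.eventuallyEq.symm

lemma injectiveNear_iff (h : IsLocalRep Ψ φ p b G) : InjectiveNear Ψ p ↔ deriv G (φ p) ≠ 0 := by
  rw [injectiveNear_congr h.eventuallyEq, injectiveNear_comp_left_iff (centeredPt_injective b),
    injectiveNear_comp_openPartialHomeomorph_iff φ h.mem_source,
    injectiveNear_iff_deriv_ne_zero h.analyticAt]

lemma eventually_eq (h : IsLocalRep Ψ φ p b G) {w : ℂ} (hG : ∀ᶠ v in 𝓝 (φ p), G v = w) :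
    ∀ᶠ z in 𝓝 p, Ψ z = centeredPt b w := by
  filter_upwards [h.eventuallyEq, (φ.continuousAt h.mem_source).eventually hG] with z hz hGz
  rw [hz, Function.comp_apply, Function.comp_apply, hGz]

lemma not_eventually_eq (h : IsLocalRep Ψ φ p b G) (hne : ¬ ∀ᶠ z in 𝓝 p, Ψ z = Ψ p) :
    ¬ ∀ᶠ w in 𝓝 (φ p), G w = G (φ p) := fun hG ↦ hne <| by
  rw [h.apply_eq]
  exact h.eventually_eq hG

lemma eventually_injectiveNear (h : IsLocalRep Ψ φ p b G) (hne : ¬ ∀ᶠ z in 𝓝 p, Ψ z = Ψ p) :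
    ∀ᶠ q in 𝓝[≠] p, InjectiveNear Ψ q := by
  have hderiv := eventually_deriv_ne_zero_of_analyticAt h.analyticAt (h.not_eventually_eq hne)
  filter_upwards [eventually_nhdsWithin_of_eventually_nhds h.eventually,
    (eventually_nhdsNE_openPartialHomeomorph_iff φ h.mem_source).1 hderiv] with q hq hqd
  exact hq.injectiveNear_iff.2 hqd

lemma eventually_eq_or_eventually_ne (h : IsLocalRep Ψ φ p b G) (c : OnePoint ℂ) :
    (∀ᶠ z in 𝓝 p, Ψ z = c) ∨ ∀ᶠ z in 𝓝[≠] p, Ψ z ≠ c := by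
  have hΨ := h.eventuallyEq.filter_mono (nhdsWithin_le_nhds (s := {p}ᶜ))
  by_cases hc : c ∈ range (centeredPt b)
  · obtain ⟨w, rfl⟩ := hc
    refine (h.analyticAt.eventually_eq_or_eventually_ne analyticAt_const).imp
      h.eventually_eq fun hG ↦ ?_
    filter_upwards [hΨ, (eventually_nhdsNE_openPartialHomeomorph_iff φ h.mem_source).1 hG]
      with z hz hGz
    rw [hz]
    exact (centeredPt_injective b).ne hGz
  · right
    filter_upwards [hΨ] with z hz hzc
    exact hc ⟨_, hz.symm.trans hzc⟩

lemma nhds_le_map (h : IsLocalRep Ψ φ p b G) (hne : ¬ ∀ᶠ z in 𝓝 p, Ψ z = Ψ p) :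
    𝓝 (Ψ p) ≤ map Ψ (𝓝 p) := by
  rw [map_congr h.eventuallyEq, ← map_map, ← map_map, φ.map_nhds_eq h.mem_source, h.apply_eq,
    ← (isOpenEmbedding_centeredPt b).map_nhds_eq]
  exact map_mono (h.analyticAt.eventually_constant_or_nhds_le_map_nhds.resolve_left
    (h.not_eventually_eq hne))

lemma invFun_comp_eventuallyEq (h : IsLocalRep Ψ φ p b G) :
    Function.invFun (centeredPt b) ∘ Ψ ∘ φ.symm =ᶠ[𝓝 (φ p)] G := by
  have hsymm : Tendsto φ.symm (𝓝 (φ p)) (𝓝 p) := by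
    simpa [φ.left_inv h.mem_source] using (φ.continuousAt_symm (φ.map_source h.mem_source)).tendsto
  filter_upwards [hsymm.eventually h.eventuallyEq, φ.eventually_right_inverse' h.mem_source]
    with v hv hinv
  simp [hv, hinv, Function.leftInverse_invFun (centeredPt_injective b) _]

lemma exists_update [DecidableEq S] (hp : p ∈ φ.source)
    (hΨ : ∀ᶠ q in 𝓝[≠] p, ∃ b G, IsLocalRep Ψ φ q b G) {R : ℝ}
    (hmem : ∀ᶠ q in 𝓝[≠] p, Ψ q ∈ centeredPt c '' Metric.ball 0 R) :
    ∃ w G, IsLocalRep (Function.update Ψ p (centeredPt c w)) φ p c G := by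
  set f := Function.invFun (centeredPt c) ∘ Ψ ∘ φ.symm
  have hf : ∀ᶠ v in 𝓝[≠] (φ p), DifferentiableAt ℂ f v := by
    rw [eventually_nhdsNE_openPartialHomeomorph_iff φ hp]
    filter_upwards [hΨ, hmem] with q ⟨b, G, hG⟩ ⟨w, _, hw⟩
    obtain ⟨G', hG', -⟩ := hG.exists_change_center hw.symm
    exact (hG'.analyticAt.congr hG'.invFun_comp_eventuallyEq.symm).differentiableAt
  have hf_mem : ∀ᶠ q in 𝓝[≠] p, f (φ q) ∈ Metric.ball 0 R ∧ Ψ q = centeredPt c (f (φ q)) := by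
    filter_upwards [hmem, nhdsWithin_le_nhds (φ.open_source.mem_nhds hp)] with q ⟨w, hw, hwq⟩ hq
    have hfw : f (φ q) = w := by
      simp [f, φ.left_inv hq, ← hwq, Function.leftInverse_invFun (centeredPt_injective c) _]
    rw [hfw]
    exact ⟨hw, hwq.symm⟩
  have hbdd : ∀ᶠ v in 𝓝[≠] (φ p), ‖f v‖ ≤ R := by
    rw [eventually_nhdsNE_openPartialHomeomorph_iff φ hp]
    exact hf_mem.mono fun q hq ↦ (mem_ball_zero_iff.1 hq.1).le
  obtain ⟨w, hw⟩ := exists_analyticAt_update hf hbdd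
  refine ⟨w, _, hp, hw, ?_⟩
  filter_upwards [eventually_nhdsWithin_iff.1 hf_mem, φ.open_source.mem_nhds hp] with q hq hqs
  by_cases hqp : q = p
  · simp [hqp]
  · simp [hqp, φ.injOn.ne hqs hp hqp, ← (hq hqp).2]

end IsLocalRep

end LocalRep

section Surface

variable {S : Type*} [TopologicalSpace S] [ChartedSpace ℂ S]

lemma nhdsNE_neBot_of_chartedSpace (p : S) : (𝓝[≠] p).NeBot := by
  by_contra h
  rw [not_neBot, ← isOpen_singleton_iff_punctured_nhds] at h
  have himage := (chartAt ℂ p).isOpen_image_of_subset_source h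
    (singleton_subset_iff.2 (mem_chart_source ℂ p))
  rw [image_singleton] at himage
  exact not_isOpen_singleton _ himage

lemma exists_isPreconnected_diff_singleton {e : S} {N : Set S} (hN : N ∈ 𝓝 e) :
    ∃ W ⊆ N, IsOpen W ∧ e ∈ W ∧ IsPreconnected (W \ {e}) := by
  set φ := chartAt ℂ e
  have he : e ∈ φ.source := mem_chart_source ℂ e
  have hNφ : φ.target ∩ φ.symm ⁻¹' N ∈ 𝓝 (φ e) := by
    refine inter_mem (φ.open_target.mem_nhds (φ.map_source he))
      ((φ.continuousAt_symm (φ.map_source he)).preimage_mem_nhds ?_)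
    rwa [φ.left_inv he]
  obtain ⟨R, hR, hballN⟩ := Metric.mem_nhds_iff.1 hNφ
  have hball : Metric.ball (φ e) R ⊆ φ.target := hballN.trans inter_subset_left
  have hcenter : φ e ∈ Metric.ball (φ e) R := Metric.mem_ball_self hR
  refine ⟨φ.symm '' Metric.ball (φ e) R, image_subset_iff.2 (hballN.trans inter_subset_right),
    φ.isOpen_image_symm_of_subset_target Metric.isOpen_ball hball,
    ⟨φ e, hcenter, φ.left_inv he⟩, ?_⟩
  have hdiff : φ.symm '' (Metric.ball (φ e) R \ {φ e}) = φ.symm '' Metric.ball (φ e) R \ {e} := by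
    rw [(φ.symm.injOn.mono hball).image_sdiff_subset (singleton_subset_iff.2 hcenter),
      image_singleton, φ.left_inv he]
  rw [← hdiff]
  exact (isPathConnected_ball_diff_singleton _ hR).isConnected.isPreconnected.image _
    (φ.continuousOn_symm.mono (sdiff_subset.trans hball))

variable {Ψ : S → OnePoint ℂ} {p q : S} {b c : OnePoint ℂ}

lemma mfderiv_eq_zero_iff {g : S → ℂ} (hg : MDifferentiableAt 𝓘(ℂ) 𝓘(ℂ) g p) :
    mfderiv 𝓘(ℂ) 𝓘(ℂ) g p = 0 ↔ deriv (g ∘ (chartAt ℂ p).symm) (chartAt ℂ p p) = 0 := by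
  have hmfderiv : mfderiv 𝓘(ℂ) 𝓘(ℂ) g p = fderiv ℂ (g ∘ (chartAt ℂ p).symm) (chartAt ℂ p p) := by
    rw [hg.mfderiv]
    simp [writtenInExtChartAt]
    rfl
  rw [hmfderiv]
  refine ⟨fun h ↦ ?_, fun h ↦ ?_⟩
  · rw [← fderiv_apply_one_eq_deriv, h]
    rfl
  · rw [← toSpanSingleton_deriv, h]
    exact ContinuousLinearMap.toSpanSingleton_zero ℂ

lemma IsLocalRep.exists_coe_or_sphereInv {G : ℂ → ℂ} (h : IsLocalRep Ψ (chartAt ℂ p) q b G) :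
    ∃ G', ∃ c, IsLocalRep Ψ (chartAt ℂ p) q c G' ∧
      ((∀ᶠ z in 𝓝 q, Ψ z = (G' (chartAt ℂ p z) : OnePoint ℂ)) ∨
        (G' (chartAt ℂ p q) = 0 ∧ ∀ᶠ z in 𝓝 q, Ψ z = sphereInv (G' (chartAt ℂ p z)))) := by
  rcases eq_or_ne (Ψ q) OnePoint.infty with hq | hq
  · obtain ⟨G', hG', hzero⟩ := h.exists_change_center (hq.trans (centeredPt_zero _).symm)
    exact ⟨G', _, hG', Or.inr ⟨hzero,
      hG'.eventuallyEq.mono fun z hz ↦ hz.trans (centeredPt_infty _)⟩⟩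
  · obtain ⟨w, hw⟩ := OnePoint.ne_infty_iff_exists.1 hq
    obtain ⟨G', hG', -⟩ := h.exists_change_center (hw.symm.trans (centeredPt_zero_eq_coe w).symm)
    exact ⟨G', _, hG', Or.inl
      (hG'.eventuallyEq.mono fun z hz ↦ hz.trans (centeredPt_zero_eq_coe _))⟩

variable [IsManifold 𝓘(ℂ) 1 S]

lemma eventually_mdifferentiableAt_iff {g : S → ℂ} (hq : q ∈ (chartAt ℂ p).source) :
    (∀ᶠ z in 𝓝 q, MDifferentiableAt 𝓘(ℂ) 𝓘(ℂ) g z) ↔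
      AnalyticAt ℂ (g ∘ (chartAt ℂ p).symm) (chartAt ℂ p q) := by
  rw [Complex.analyticAt_iff_eventually_differentiableAt, (chartAt ℂ p).eventually_nhds _ hq]
  refine eventually_congr ?_
  filter_upwards [(chartAt ℂ p).open_source.mem_nhds hq] with z hz
  rw [mdifferentiableAt_iff_source_of_mem_source hz]
  simp [mdifferentiableWithinAt_univ, mdifferentiableAt_iff_differentiableAt]

lemma isLocalRep_of_eventually_mdifferentiableAt {g : S → ℂ} (hq : q ∈ (chartAt ℂ p).source)
    (hg : ∀ᶠ z in 𝓝 q, MDifferentiableAt 𝓘(ℂ) 𝓘(ℂ) g z)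
    (hΨ : ∀ᶠ z in 𝓝 q, Ψ z = centeredPt b (g z)) :
    IsLocalRep Ψ (chartAt ℂ p) q b (g ∘ (chartAt ℂ p).symm) := by
  refine ⟨hq, (eventually_mdifferentiableAt_iff hq).1 hg, ?_⟩
  filter_upwards [hΨ, (chartAt ℂ p).eventually_left_inverse hq] with z hz hinv
  simp [hz, hinv]

lemma IsLocalRep.eventually_mdifferentiableAt {G : ℂ → ℂ} (h : IsLocalRep Ψ (chartAt ℂ p) q b G) :
    ∀ᶠ z in 𝓝 q, MDifferentiableAt 𝓘(ℂ) 𝓘(ℂ) (G ∘ chartAt ℂ p) z := by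
  rw [eventually_mdifferentiableAt_iff h.mem_source]
  refine h.analyticAt.congr ?_
  filter_upwards [(chartAt ℂ p).eventually_right_inverse' h.mem_source] with w hw
  simp [hw]

lemma MeromorphicNear.exists_isLocalRep (h : MeromorphicNear Ψ q) (hq : q ∈ (chartAt ℂ p).source) :
    ∃ b G, IsLocalRep Ψ (chartAt ℂ p) q b G := by
  obtain ⟨g, hg, hΨ | hΨ⟩ := h
  · exact ⟨_, _, isLocalRep_of_eventually_mdifferentiableAt hq hg
      (hΨ.mono fun z hz ↦ hz.trans (centeredPt_zero_eq_coe _).symm)⟩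
  · exact ⟨_, _, isLocalRep_of_eventually_mdifferentiableAt hq hg
      (hΨ.mono fun z hz ↦ hz.trans (centeredPt_infty _).symm)⟩

lemma IsLocalRep.meromorphicNear {G : ℂ → ℂ} (h : IsLocalRep Ψ (chartAt ℂ p) q b G) :
    MeromorphicNear Ψ q := by
  obtain ⟨G', c, hG', hΨ⟩ := h.exists_coe_or_sphereInv
  exact ⟨_, hG'.eventually_mdifferentiableAt, hΨ.imp id And.right⟩

lemma isCriticalPt_iff : IsCriticalPt Ψ p ↔ MeromorphicNear Ψ p ∧ ¬ InjectiveNear Ψ p := by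
  constructor
  · rintro ⟨g, hg, hcrit, hΨ⟩
    refine ⟨⟨g, hg, hΨ.imp id And.right⟩, ?_⟩
    obtain ⟨b, hb⟩ : ∃ b, ∀ᶠ z in 𝓝 p, Ψ z = centeredPt b (g z) := by
      rcases hΨ with hΨ | ⟨-, hΨ⟩
      · exact ⟨_, hΨ.mono fun z hz ↦ hz.trans (centeredPt_zero_eq_coe _).symm⟩
      · exact ⟨_, hΨ.mono fun z hz ↦ hz.trans (centeredPt_infty _).symm⟩
    have hrep := isLocalRep_of_eventually_mdifferentiableAt (mem_chart_source ℂ p) hg hb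
    rw [hrep.injectiveNear_iff, not_not]
    exact (mfderiv_eq_zero_iff hg.self_of_nhds).1 hcrit
  · rintro ⟨hmero, hinj⟩
    obtain ⟨b, G, hG⟩ := hmero.exists_isLocalRep (mem_chart_source ℂ p)
    obtain ⟨G', c, hG', hΨ⟩ := hG.exists_coe_or_sphereInv
    have hd := hG'.eventually_mdifferentiableAt
    refine ⟨_, hd, (mfderiv_eq_zero_iff hd.self_of_nhds).2 ?_, hΨ⟩
    have heq : (G' ∘ chartAt ℂ p) ∘ (chartAt ℂ p).symm =ᶠ[𝓝 (chartAt ℂ p p)] G' :=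
      ((chartAt ℂ p).eventually_right_inverse' hG'.mem_source).mono fun w hw ↦ congrArg G' hw
    rw [heq.deriv_eq]
    exact not_not.1 (mt hG'.injectiveNear_iff.2 hinj)

namespace MeromorphicNear

lemma continuousAt (h : MeromorphicNear Ψ p) : ContinuousAt Ψ p :=
  have ⟨_, _, hG⟩ := h.exists_isLocalRep (mem_chart_source ℂ p)
  hG.continuousAt

lemma eventually_injectiveNear (h : MeromorphicNear Ψ p) (hne : ¬ ∀ᶠ z in 𝓝 p, Ψ z = Ψ p) :
    ∀ᶠ q in 𝓝[≠] p, InjectiveNear Ψ q :=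
  have ⟨_, _, hG⟩ := h.exists_isLocalRep (mem_chart_source ℂ p)
  hG.eventually_injectiveNear hne

lemma eventually_eq_or_eventually_ne (h : MeromorphicNear Ψ p) (c : OnePoint ℂ) :
    (∀ᶠ z in 𝓝 p, Ψ z = c) ∨ ∀ᶠ z in 𝓝[≠] p, Ψ z ≠ c :=
  have ⟨_, _, hG⟩ := h.exists_isLocalRep (mem_chart_source ℂ p)
  hG.eventually_eq_or_eventually_ne c

lemma nhds_le_map (h : MeromorphicNear Ψ p) (hne : ¬ ∀ᶠ z in 𝓝 p, Ψ z = Ψ p) :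
    𝓝 (Ψ p) ≤ map Ψ (𝓝 p) :=
  have ⟨_, _, hG⟩ := h.exists_isLocalRep (mem_chart_source ℂ p)
  hG.nhds_le_map hne

lemma eventually_eq_of_mem_closure (h : MeromorphicNear Ψ p)
    (hp : p ∈ closure {q | ∀ᶠ z in 𝓝 q, Ψ z = c}) : ∀ᶠ z in 𝓝 p, Ψ z = c := by
  refine (h.eventually_eq_or_eventually_ne c).resolve_right fun hne ↦ ?_
  obtain ⟨q, hqc, hqne⟩ := ((mem_closure_iff_frequently.1 hp).and_eventually
    (eventually_nhdsWithin_iff.1 hne).eventually_nhds).exists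
  have hqp : ∀ᶠ z in 𝓝 q, z = p := by
    filter_upwards [hqc, hqne] with z hz hzne using by_contra fun hzp ↦ hzne hzp hz
  obtain rfl := hqp.self_of_nhds
  have := nhdsNE_neBot_of_chartedSpace q
  obtain ⟨z, hz, hzq⟩ :=
    ((eventually_nhdsWithin_of_eventually_nhds hqp).and
      (eventually_mem_nhdsWithin (s := {q}ᶜ))).exists
  exact hzq hz

end MeromorphicNear

lemma eventually_eq_of_isPreconnected {W : Set S} (hW : IsPreconnected W)
    (hmero : ∀ q ∈ W, MeromorphicNear Ψ q) (hp : p ∈ W) (h : ∀ᶠ z in 𝓝 p, Ψ z = c) :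
    ∀ q ∈ W, ∀ᶠ z in 𝓝 q, Ψ z = c :=
  hW.subset_of_closure_inter_subset isOpen_setOfPred_eventually_nhds ⟨p, hp, h⟩
    fun q hq ↦ (hmero q hq.2).eventually_eq_of_mem_closure hq.1

namespace IsTranscendentalMeromorphic

variable {e : S}

theorem not_eventually_eq [ConnectedSpace S] (hΨ : IsTranscendentalMeromorphic e Ψ)
    (c : OnePoint ℂ) (hp : p ≠ e) : ¬ ∀ᶠ z in 𝓝 p, Ψ z = c := by
  intro hconst
  set u := {q | ∀ᶠ z in 𝓝 q, Ψ z = c}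
  obtain ⟨W, -, hW, heW, hWc⟩ := exists_isPreconnected_diff_singleton (univ_mem (f := 𝓝 e))
  have hmero : ∀ q ∈ W \ {e}, MeromorphicNear Ψ q := fun q hq ↦ hΨ.meromorphic q hq.2
  have hdisj : ∀ q ∈ W \ {e}, q ∉ u := by
    intro q hq hqu
    classical
    refine hΨ.essential (Function.update Ψ e c) (fun z hz ↦ Function.update_of_ne hz _ _) ?_
    have hrep : IsLocalRep (Function.update Ψ e c) (chartAt ℂ e) e c (fun _ ↦ 0) := by
      refine ⟨mem_chart_source ℂ e, analyticAt_const, ?_⟩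
      filter_upwards [hW.mem_nhds heW] with z hz
      rcases eq_or_ne z e with rfl | hze
      · simp
      · simp [hze, (eventually_eq_of_isPreconnected hWc hmero hq hqu z ⟨hz, hze⟩).self_of_nhds]
    exact hrep.meromorphicNear
  have hclosure : closure u ⊆ u := by
    intro q hq
    by_cases hqe : q = e
    · obtain ⟨z, hzW, hzu⟩ := mem_closure_iff.1 hq W hW (hqe ▸ heW)
      by_cases hze : z = e
      · rwa [hqe, ← hze]
      · exact absurd hzu (hdisj z ⟨hzW, hze⟩)
    · exact (hΨ.meromorphic q hqe).eventually_eq_of_mem_closure hq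
  have huniv : u = univ := IsClopen.eq_univ
    ⟨isClosed_of_closure_subset hclosure, isOpen_setOfPred_eventually_nhds⟩ ⟨p, hconst⟩
  have := nhdsNE_neBot_of_chartedSpace e
  obtain ⟨q, hqW, hqe⟩ :=
    ((eventually_nhdsWithin_of_eventually_nhds (hW.eventually_mem heW)).and
      (eventually_mem_nhdsWithin (s := {e}ᶜ))).exists
  exact hdisj q ⟨hqW, hqe⟩ (huniv ▸ mem_univ q)

theorem not_eventually_mem_sphericalDisk (hΨ : IsTranscendentalMeromorphic e Ψ)
    {a : OnePoint ℂ} {r : ℝ} (hr : 0 < r) (hr' : r < Real.pi) :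
    ¬ ∀ᶠ z in 𝓝[≠] e, Ψ z ∈ sphericalDisk a r := by
  intro hmem
  classical
  rw [sphericalDisk_eq_image hr hr'] at hmem
  have hrep : ∀ᶠ q in 𝓝[≠] e, ∃ b G, IsLocalRep Ψ (chartAt ℂ e) q b G := by
    filter_upwards [self_mem_nhdsWithin,
      nhdsWithin_le_nhds ((chartAt ℂ e).open_source.mem_nhds (mem_chart_source ℂ e))] with q hqe hq
    exact (hΨ.meromorphic q hqe).exists_isLocalRep hq
  obtain ⟨w, G, hG⟩ := IsLocalRep.exists_update (mem_chart_source ℂ e) hrep hmem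
  exact hΨ.essential _ (fun z hz ↦ Function.update_of_ne hz _ _) hG.meromorphicNear

end IsTranscendentalMeromorphic

end Surface

section InverseGerm

variable {S : Type*} {Ψ : S → OnePoint ℂ} {p e : S}

lemma diskPreimage_mono (b : OnePoint ℂ) {ρ₁ ρ₂ : ℝ} (h : ρ₁ ≤ ρ₂) :
    diskPreimage e Ψ b ρ₁ ⊆ diskPreimage e Ψ b ρ₂ :=
  fun _ hz ↦ ⟨hz.1, sphericalDisk_mono b h hz.2⟩

variable [TopologicalSpace S]

namespace InverseGerm

lemma nhd_subset (U : InverseGerm e Ψ) (ρ : Ioi (0 : ℝ)) :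
    U.nhd ρ ⊆ diskPreimage e Ψ U.base ρ := by
  obtain ⟨z, -, hU⟩ := U.isComponent ρ
  exact hU ▸ connectedComponentIn_subset _ _

lemma nonempty_nhd (U : InverseGerm e Ψ) (ρ : Ioi (0 : ℝ)) : (U.nhd ρ).Nonempty := by
  obtain ⟨z, hz, hU⟩ := U.isComponent ρ
  exact ⟨z, hU ▸ mem_connectedComponentIn hz⟩

lemma isPreconnected_nhd (U : InverseGerm e Ψ) (ρ : Ioi (0 : ℝ)) : IsPreconnected (U.nhd ρ) := by
  obtain ⟨z, -, hU⟩ := U.isComponent ρ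
  exact hU ▸ isPreconnected_connectedComponentIn

instance preconnectedSpace_nhd (U : InverseGerm e Ψ) (ρ : Ioi (0 : ℝ)) :
    PreconnectedSpace (U.nhd ρ) :=
  isPreconnected_iff_preconnectedSpace.1 (U.isPreconnected_nhd ρ)

lemma nhd_eq_of_mem (U : InverseGerm e Ψ) {ρ : Ioi (0 : ℝ)} {x : S} (hx : x ∈ U.nhd ρ) :
    U.nhd ρ = connectedComponentIn (diskPreimage e Ψ U.base ρ) x := by
  obtain ⟨z, -, hU⟩ := U.isComponent ρ
  rw [hU] at hx ⊢
  exact connectedComponentIn_eq hx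

lemma monotone_nhd (U : InverseGerm e Ψ) : Monotone U.nhd :=
  monotone_iff_forall_lt.2 fun _ _ h ↦ U.mono _ _ h

lemma subset_nhd (U : InverseGerm e Ψ) {ρ : Ioi (0 : ℝ)} {T : Set S} (hT : IsPreconnected T)
    (hTD : T ⊆ diskPreimage e Ψ U.base ρ) (hne : (T ∩ U.nhd ρ).Nonempty) : T ⊆ U.nhd ρ := by
  obtain ⟨x, hxT, hxU⟩ := hne
  rw [U.nhd_eq_of_mem hxU]
  exact hT.subset_connectedComponentIn hxT hTD

lemma eq_of_forall_inter_nonempty {U V : InverseGerm e Ψ} (hb : V.base = U.base)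
    (h : ∀ ρ, (V.nhd ρ ∩ U.nhd ρ).Nonempty) : V = U := by
  refine InverseGerm.ext hb (funext fun ρ ↦ Subset.antisymm ?_ ?_)
  · exact U.subset_nhd (V.isPreconnected_nhd ρ) (hb ▸ V.nhd_subset ρ) (h ρ)
  · exact V.subset_nhd (U.isPreconnected_nhd ρ) (hb ▸ U.nhd_subset ρ) (inter_comm _ _ ▸ h ρ)

lemma ne_of_forall_mem_nhd (V : InverseGerm e Ψ) {x : S} (hx : ∀ ρ, x ∈ V.nhd ρ) : x ≠ e :=
  (V.nhd_subset ⟨1, mem_Ioi.2 one_pos⟩ (hx _)).1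

lemma apply_eq_base_of_forall_mem_nhd (V : InverseGerm e Ψ) {x : S} (hx : ∀ ρ, x ∈ V.nhd ρ) :
    Ψ x = V.base :=
  eq_of_forall_mem_sphericalDisk fun ρ ↦ (V.nhd_subset ρ (hx ρ)).2

/-- The germ at a point `p ≠ e`, formed by the components that contain `p`. -/
def ofPoint (Ψ : S → OnePoint ℂ) (hp : p ≠ e) : InverseGerm e Ψ where
  base := Ψ p
  nhd ρ := connectedComponentIn (diskPreimage e Ψ (Ψ p) ρ) p
  isComponent ρ := ⟨p, ⟨hp, center_mem_sphericalDisk _ ρ.2⟩, rfl⟩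
  mono _ _ h := connectedComponentIn_mono _ (diskPreimage_mono _ h.le)

lemma mem_nhd_ofPoint (hp : p ≠ e) (ρ : Ioi (0 : ℝ)) : p ∈ (ofPoint Ψ hp).nhd ρ :=
  mem_connectedComponentIn ⟨hp, center_mem_sphericalDisk _ ρ.2⟩

lemma IsSingularity.isCriticalPt [ChartedSpace ℂ S] {V : InverseGerm e Ψ} (hV : V.IsSingularity)
    {x : S} (hx : ∀ ρ, x ∈ V.nhd ρ) : IsCriticalPt Ψ x := by
  rw [← mem_iInter] at hx
  rcases hV with ⟨z, hz, hcrit⟩ | hV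
  · rw [hz, mem_singleton_iff] at hx
    rwa [hx]
  · rw [hV] at hx
    exact absurd hx (notMem_empty x)

end InverseGerm

variable [ChartedSpace ℂ S] [IsManifold 𝓘(ℂ) 1 S]

namespace IsTranscendentalMeromorphic

variable (hΨ : IsTranscendentalMeromorphic e Ψ)
include hΨ

lemma continuousAt (hp : p ≠ e) : ContinuousAt Ψ p := (hΨ.meromorphic p hp).continuousAt

lemma sphericalDist_le_of_mem_closure (U : InverseGerm e Ψ) {ρ : Ioi (0 : ℝ)} {x : S} (hxe : x ≠ e)
    (hx : x ∈ closure (U.nhd ρ)) : sphericalDist (Ψ x) U.base ≤ ρ := by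
  have himage : Ψ '' U.nhd ρ ⊆ {t | sphericalDist t U.base ≤ ρ} := by
    rintro _ ⟨y, hy, rfl⟩
    have hlt : sphericalDist (Ψ y) U.base < ρ := (U.nhd_subset ρ hy).2
    exact hlt.le
  exact closure_minimal himage (isClosed_sphericalDist_le _ _)
    (mem_closure_image (hΨ.continuousAt hxe) hx)

section T1

variable [T1Space S]

lemma isOpen_diskPreimage (b : OnePoint ℂ) (ρ : ℝ) : IsOpen (diskPreimage e Ψ b ρ) := by
  rw [isOpen_iff_mem_nhds]
  rintro z ⟨hz, hzD⟩
  exact inter_mem (isOpen_ne.mem_nhds hz)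
    ((hΨ.continuousAt hz).preimage_mem_nhds ((isOpen_sphericalDisk b ρ).mem_nhds hzD))

lemma isOpen_connectedComponentIn (b : OnePoint ℂ) (ρ : ℝ) (z : S) :
    IsOpen (connectedComponentIn (diskPreimage e Ψ b ρ) z) :=
  have := ChartedSpace.locallyConnectedSpace ℂ S
  (hΨ.isOpen_diskPreimage b ρ).connectedComponentIn

lemma isOpen_nhd (U : InverseGerm e Ψ) (ρ : Ioi (0 : ℝ)) : IsOpen (U.nhd ρ) := by
  obtain ⟨z, -, hU⟩ := U.isComponent ρ
  exact hU ▸ hΨ.isOpen_connectedComponentIn _ _ _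

lemma mem_nhd_of_mem_closure (U : InverseGerm e Ψ) {ρ : Ioi (0 : ℝ)} {x : S}
    (hx : x ∈ closure (U.nhd ρ)) (hxD : x ∈ diskPreimage e Ψ U.base ρ) : x ∈ U.nhd ρ :=
  U.subset_nhd isPreconnected_connectedComponentIn (connectedComponentIn_subset _ x)
    (mem_closure_iff.1 hx _ (hΨ.isOpen_connectedComponentIn _ _ _) (mem_connectedComponentIn hxD))
    (mem_connectedComponentIn hxD)

lemma mem_nhd_of_forall_mem_closure (V : InverseGerm e Ψ) {x : S} (hxe : x ≠ e)
    (hx : ∀ ρ, x ∈ closure (V.nhd ρ)) (ρ : Ioi (0 : ℝ)) : x ∈ V.nhd ρ := by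
  have hbase : Ψ x = V.base := eq_of_forall_mem_sphericalDisk fun ρ ↦
    (hΨ.sphericalDist_le_of_mem_closure V hxe (hx ⟨ρ / 2, mem_Ioi.2 (half_pos ρ.2)⟩)).trans_lt
      (half_lt_self ρ.2)
  exact hΨ.mem_nhd_of_mem_closure V (hx ρ) ⟨hxe, hbase ▸ center_mem_sphericalDisk _ ρ.2⟩

end T1

variable [T2Space S]

lemma exists_forall_mem_nhd_of_isCompact (V : InverseGerm e Ψ) {K : Set S} (hK : IsCompact K)
    (heK : e ∉ K) (hV : ∀ ρ, (V.nhd ρ ∩ K).Nonempty) : ∃ x ∈ K, ∀ ρ, x ∈ V.nhd ρ := by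
  have : Nonempty (Ioi (0 : ℝ)) := ⟨⟨1, mem_Ioi.2 one_pos⟩⟩
  obtain ⟨x, hx⟩ : (⋂ ρ, K ∩ closure (V.nhd ρ)).Nonempty := by
    refine IsCompact.nonempty_iInter_of_directed_nonempty_isCompact_isClosed _ ?_ ?_ ?_ ?_
    · exact Monotone.directed_ge fun _ _ h ↦
        inter_subset_inter_right _ (closure_mono (V.monotone_nhd h))
    · exact fun ρ ↦ (hV ρ).mono fun x hx ↦ ⟨hx.2, subset_closure hx.1⟩
    · exact fun ρ ↦ hK.inter_right isClosed_closure
    · exact fun ρ ↦ hK.isClosed.inter isClosed_closure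
  rw [← inter_iInter, mem_inter_iff, mem_iInter] at hx
  exact ⟨x, hx.1, hΨ.mem_nhd_of_forall_mem_closure V (ne_of_mem_of_not_mem hx.1 heK) hx.2⟩

variable [ConnectedSpace S]

lemma exists_nhd_subset (U : InverseGerm e Ψ) (hp : ∀ ρ, p ∈ U.nhd ρ) {N : Set S}
    (hN : N ∈ 𝓝 p) : ∃ ρ, U.nhd ρ ⊆ N := by
  have := ChartedSpace.locallyCompactSpace ℂ S
  have hpe := U.ne_of_forall_mem_nhd hp
  have hne := eventually_nhdsWithin_iff.1 (((hΨ.meromorphic p hpe).eventually_eq_or_eventually_ne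
    (Ψ p)).resolve_left (hΨ.not_eventually_eq _ hpe))
  obtain ⟨K, hKp, hKsub, hK⟩ := local_compact_nhds
    (inter_mem (inter_mem hN hne) (isOpen_ne.mem_nhds hpe))
  by_contra! hcon
  obtain ⟨x, hxF, hx⟩ := hΨ.exists_forall_mem_nhd_of_isCompact U (hK.diff isOpen_interior)
    (fun he ↦ (hKsub he.1).2 rfl) fun ρ ↦ by
    by_contra! hempty
    refine hcon ρ (((U.isPreconnected_nhd ρ).subset_of_closure_inter_subset isOpen_interior
      ⟨p, hp ρ, mem_interior_iff_mem_nhds.2 hKp⟩ fun z hz ↦ ?_).trans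
      (interior_subset.trans fun z hz ↦ (hKsub hz).1.1))
    by_contra hzK
    have hz' : z ∈ U.nhd ρ ∩ (K \ interior K) :=
      ⟨hz.2, hK.isClosed.closure_interior_subset hz.1, hzK⟩
    rwa [hempty] at hz'
  have hxp : x ≠ p := fun h ↦ hxF.2 (h ▸ mem_interior_iff_mem_nhds.2 hKp)
  exact (hKsub hxF.1).1.2 hxp ((U.apply_eq_base_of_forall_mem_nhd hx).trans
    (U.apply_eq_base_of_forall_mem_nhd hp).symm)

lemma iInter_nhd_eq_singleton (U : InverseGerm e Ψ) (hp : ∀ ρ, p ∈ U.nhd ρ) :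
    ⋂ ρ, U.nhd ρ = {p} := by
  refine Subset.antisymm (fun q hq ↦ ?_) (singleton_subset_iff.2 (mem_iInter.2 hp))
  by_contra hqp
  obtain ⟨ρ, hρ⟩ := hΨ.exists_nhd_subset U hp (isOpen_ne.mem_nhds (Ne.symm hqp))
  exact hρ (mem_iInter.1 hq ρ) rfl

theorem isSeparate_of_isAlgebraic {U : InverseGerm e Ψ} (hU : U.IsAlgebraic) : U.IsSeparate := by
  have := ChartedSpace.locallyCompactSpace ℂ S
  obtain ⟨z, hz, -⟩ := hU
  have hzU : ∀ ρ, z ∈ U.nhd ρ := mem_iInter.1 (hz ▸ mem_singleton z)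
  have hze := U.ne_of_forall_mem_nhd hzU
  have hinj := eventually_nhdsWithin_iff.1
    ((hΨ.meromorphic z hze).eventually_injectiveNear (hΨ.not_eventually_eq _ hze))
  obtain ⟨K, hKz, hKsub, hK⟩ := local_compact_nhds (inter_mem hinj (isOpen_ne.mem_nhds hze))
  obtain ⟨ρ₁, hρ₁⟩ := hΨ.exists_nhd_subset U hzU hKz
  refine ⟨ρ₁, fun V hV hVU ↦ ?_⟩
  by_contra! hmeet
  obtain ⟨x, hxK, hxV⟩ := hΨ.exists_forall_mem_nhd_of_isCompact V hK (fun he ↦ (hKsub he).2 rfl)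
    fun ρ ↦ by
      obtain ⟨y, hyU, hyV⟩ := not_disjoint_iff.1 (hmeet ρ)
      exact ⟨y, hyV, hρ₁ hyU⟩
  obtain rfl : x = z := by
    by_contra hxz
    exact (isCriticalPt_iff.1 (hV.isCriticalPt hxV)).2 ((hKsub hxK).1 hxz)
  refine hVU (InverseGerm.eq_of_forall_inter_nonempty ?_ fun ρ ↦ ⟨x, hxV ρ, hzU ρ⟩)
  rw [← V.apply_eq_base_of_forall_mem_nhd hxV, U.apply_eq_base_of_forall_mem_nhd hzU]

end IsTranscendentalMeromorphic

end InverseGerm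

/-- The exponential map in the coordinate centred at `a`, a universal covering of the sphere
punctured at `a` and at its antipode. -/
def expPt (a : OnePoint ℂ) (s : ℂ) : OnePoint ℂ := centeredPt a (Complex.exp s)

lemma continuous_expPt (a : OnePoint ℂ) : Continuous (expPt a) :=
  (continuous_centeredPt a).comp Complex.continuous_exp

lemma range_expPt (a : OnePoint ℂ) : range (expPt a) = centeredPt a '' {0}ᶜ := by
  change range (centeredPt a ∘ Complex.exp) = _
  rw [range_comp, Complex.range_exp]

lemma mem_range_expPt {a t : OnePoint ℂ} :
    t ∈ range (expPt a) ↔ t ∈ range (centeredPt a) ∧ t ≠ a := by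
  rw [range_expPt, image_compl_eq_range_sdiff_image (centeredPt_injective a), image_singleton,
    centeredPt_zero]
  rfl

lemma expPt_ne (a : OnePoint ℂ) (s : ℂ) : expPt a s ≠ a := (mem_range_expPt.1 ⟨s, rfl⟩).2

lemma sphericalDist_expPt (a : OnePoint ℂ) (s : ℂ) :
    sphericalDist (expPt a s) a = 2 * Real.arctan (Real.exp s.re) := by
  rw [expPt, sphericalDist_centeredPt, Complex.norm_exp]

lemma expPt_eq_expPt_iff {a : OnePoint ℂ} {s s' : ℂ} :
    expPt a s = expPt a s' ↔ ∃ n : ℤ, s = s' + n * (2 * Real.pi * Complex.I) := by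
  rw [← Complex.exp_eq_exp_iff_exists_int]
  exact (centeredPt_injective a).eq_iff

lemma finite_compl_range_expPt (a : OnePoint ℂ) : (range (expPt a))ᶜ.Finite := by
  refine (toFinite {a, centering a • OnePoint.infty}).subset fun t ht ↦ ?_
  rw [mem_compl_iff, mem_range_expPt, not_and_or, not_not] at ht
  exact ht.symm.imp_right eq_centering_smul_infty

lemma exists_isPathConnected_sphericalDisk (a : OnePoint ℂ) {b : OnePoint ℂ}
    {N : Set (OnePoint ℂ)} (hN : N ∈ 𝓝 b) :
    ∃ r, 0 < r ∧ sphericalDisk b r ⊆ N ∧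
      IsPathConnected (sphericalDisk b r ∩ range (expPt a)) := by
  have hfin : ((range (expPt a))ᶜ \ {b}).Finite := (finite_compl_range_expPt a).sdiff
  obtain ⟨r, hr, hr', hrN⟩ := exists_sphericalDisk_subset
    (inter_mem hN (hfin.isClosed.isOpen_compl.mem_nhds fun h ↦ h.2 rfl))
  have hrange : ∀ t ∈ sphericalDisk b r, t ≠ b → t ∈ range (expPt a) := fun t ht htb ↦ by
    by_contra hta
    exact (hrN ht).2 ⟨hta, htb⟩
  refine ⟨r, hr, hrN.trans inter_subset_left, ?_⟩
  have hR := tan_half_pos hr hr'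
  by_cases hb : b ∈ range (expPt a)
  · have hsub : sphericalDisk b r ⊆ range (expPt a) := fun t ht ↦
      (eq_or_ne t b).elim (fun h ↦ h ▸ hb) (hrange t ht)
    rw [inter_eq_left.2 hsub, sphericalDisk_eq_image hr hr']
    exact (Metric.isPathConnected_ball hR).image (continuous_centeredPt b)
  · have hdiff : sphericalDisk b r ∩ range (expPt a) = sphericalDisk b r \ {b} :=
      Subset.antisymm (fun t ht ↦ ⟨ht.1, fun h ↦ hb (h ▸ ht.2)⟩)
        fun t ht ↦ ⟨ht.1, hrange t ht.1 ht.2⟩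
    have himage : centeredPt b '' {0} = {b} := by rw [image_singleton, centeredPt_zero]
    rw [hdiff, sphericalDisk_eq_image hr hr', ← himage, ← image_sdiff (centeredPt_injective b)]
    exact (isPathConnected_ball_diff_singleton _ hR).image (continuous_centeredPt b)

lemma isCoveringMapOn_expPt (a : OnePoint ℂ) : IsCoveringMapOn (expPt a) (range (expPt a)) := by
  have hemb : IsOpenEmbedding fun z : {z : ℂ // z ≠ 0} ↦ centeredPt a z :=
    (isOpenEmbedding_centeredPt a).comp (IsOpen.isOpenEmbedding_subtypeVal isOpen_ne)
  have hrange : range (expPt a) = range fun z : {z : ℂ // z ≠ 0} ↦ centeredPt a z := by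
    rw [range_expPt, image_eq_range]
    rfl
  rw [hrange]
  exact .of_isCoveringMap_subtype hemb.isOpen_range (fun s ↦ ⟨⟨_, Complex.exp_ne_zero s⟩, rfl⟩)
    (Complex.isCoveringMap_exp.homeomorph_comp hemb.isEmbedding.toHomeomorph)

lemma exists_path_lift_expPt {a : OnePoint ℂ} (γ : C(I, OnePoint ℂ))
    (hγ : ∀ t, γ t ∈ range (expPt a)) {s : ℂ} (hs : expPt a s = γ 0) :
    ∃ Γ : C(I, ℂ), Γ 0 = s ∧ ∀ t, expPt a (Γ t) = γ t := by
  obtain ⟨Γ, hΓ, hΓ0⟩ :=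
    (isCoveringMapOn_expPt a).isCoveringMap_restrictPreimage.exists_path_lifts
      ⟨fun t ↦ ⟨γ t, hγ t⟩, γ.continuous.subtype_mk hγ⟩ ⟨s, s, rfl⟩ (Subtype.ext hs.symm)
  exact ⟨⟨fun t ↦ Γ t, by fun_prop⟩, congrArg Subtype.val hΓ0,
    fun t ↦ congrArg Subtype.val (congrFun hΓ t)⟩

lemma isLocalHomeomorph_expPt (a : OnePoint ℂ) : IsLocalHomeomorph (expPt a) := by
  rw [isLocalHomeomorph_iff_isLocalHomeomorphOn_univ]
  exact (isCoveringMapOn_expPt a).isLocalHomeomorphOn.mono fun s _ ↦ ⟨s, rfl⟩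

lemma sphericalDisk_diff_subset_range_expPt {a : OnePoint ℂ} {ρ : ℝ} (hρ : ρ ≤ Real.pi) :
    sphericalDisk a ρ \ {a} ⊆ range (expPt a) := fun _ ht ↦
  mem_range_expPt.2 ⟨sphericalDisk_subset_range hρ ht.1, ht.2⟩

/-- The half-plane that the exponential map, in any centred coordinate, maps to the punctured disk
of radius `ρ`; the whole plane if `π ≤ ρ`. -/
def expHalfPlane (ρ : ℝ) : Set ℂ := {s | 2 * Real.arctan (Real.exp s.re) < ρ}

lemma expPt_mem_sphericalDisk {a : OnePoint ℂ} {s : ℂ} {ρ : ℝ} :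
    expPt a s ∈ sphericalDisk a ρ ↔ s ∈ expHalfPlane ρ := by
  rw [sphericalDisk, mem_ofPred_eq, sphericalDist_expPt]
  rfl

lemma monotone_two_mul_arctan_exp : Monotone fun x : ℝ ↦ 2 * Real.arctan (Real.exp x) :=
  (Real.arctan_strictMono.monotone.comp Real.exp_monotone).const_mul zero_le_two

lemma expHalfPlane_of_re_le {ρ : ℝ} {s s' : ℂ} (hs : s ∈ expHalfPlane ρ) (h : s'.re ≤ s.re) :
    s' ∈ expHalfPlane ρ :=
  (monotone_two_mul_arctan_exp h).trans_lt hs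

lemma expHalfPlane_mono {ρ₁ ρ₂ : ℝ} (h : ρ₁ ≤ ρ₂) : expHalfPlane ρ₁ ⊆ expHalfPlane ρ₂ :=
  fun _ hs ↦ lt_of_lt_of_le hs h

lemma convex_expHalfPlane (ρ : ℝ) : Convex ℝ (expHalfPlane ρ) :=
  (isLowerSet_Iio ρ |>.preimage monotone_two_mul_arctan_exp).ordConnected.convex.linear_preimage
    Complex.reLm

lemma isOpen_expHalfPlane (ρ : ℝ) : IsOpen (expHalfPlane ρ) :=
  isOpen_lt (by fun_prop) continuous_const

instance preconnectedSpace_expHalfPlane (ρ : ℝ) : PreconnectedSpace (expHalfPlane ρ) :=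
  isPreconnected_iff_preconnectedSpace.1 (convex_expHalfPlane ρ).isPreconnected

lemma nonempty_expHalfPlane {ρ : ℝ} (hρ : 0 < ρ) : (expHalfPlane ρ).Nonempty := by
  obtain ⟨r, -, hrN, hc⟩ := exists_isPathConnected_sphericalDisk OnePoint.infty
    (sphericalDisk_mem_nhds OnePoint.infty hρ)
  obtain ⟨_, hsr, s, rfl⟩ := hc.nonempty
  exact ⟨s, expPt_mem_sphericalDisk.1 (hrN hsr)⟩

section Lift

variable {Y : Type*} [TopologicalSpace Y] [T2Space Y] {q : Y → OnePoint ℂ} {a : OnePoint ℂ} {ρ : ℝ}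

/-- Paths in the disk of radius `ρ` around `a`, punctured at `a` and at the antipode of `a`, lift
through `q`. -/
def HasPathLifts (q : Y → OnePoint ℂ) (a : OnePoint ℂ) (ρ : ℝ) : Prop :=
  ∀ γ : C(I, OnePoint ℂ), (∀ t, γ t ∈ sphericalDisk a ρ ∩ range (expPt a)) →
    ∀ y : Y, q y = γ 0 → ∃ Γ : C(I, Y), Γ 0 = y ∧ ∀ t, q (Γ t) = γ t

lemma HasPathLifts.exists_expPt_lift [Nonempty Y] (hq : IsLocalHomeomorph q)
    (hqD : ∀ y, q y ∈ sphericalDisk a ρ) (hpl : HasPathLifts q a ρ) :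
    ∃ F : C(expHalfPlane ρ, Y), ∀ s, q (F s) = expPt a s := by
  obtain ⟨y₁⟩ := ‹Nonempty Y›
  obtain ⟨r, -, hrN, hc⟩ := exists_isPathConnected_sphericalDisk a
    (hq.isOpenMap.isOpen_range.mem_nhds ⟨y₁, rfl⟩)
  obtain ⟨_, hs₀r, s₀, rfl⟩ := hc.nonempty
  obtain ⟨y₀, h₀⟩ := hrN hs₀r
  have hs₀ : s₀ ∈ expHalfPlane ρ := expPt_mem_sphericalDisk.1 (h₀ ▸ hqD y₀)
  set ℓ : I × expHalfPlane ρ → ℂ := fun x ↦ s₀ + (x.1 : ℝ) • ((x.2 : ℂ) - s₀) with hℓ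
  have hℓmem : ∀ x, ℓ x ∈ expHalfPlane ρ := fun x ↦
    (convex_expHalfPlane ρ).add_smul_sub_mem hs₀ x.2.2 x.1.2
  have hℓc : Continuous ℓ := by fun_prop
  have hlift : ∀ s : expHalfPlane ρ, ∃ Γ : C(I, Y), Γ 0 = y₀ ∧
      ∀ t, q (Γ t) = expPt a (ℓ (t, s)) := by
    intro s
    refine hpl ⟨fun t ↦ expPt a (ℓ (t, s)), (continuous_expPt a).comp (by fun_prop)⟩ ?_ y₀ ?_
    · exact fun t ↦ ⟨expPt_mem_sphericalDisk.2 (hℓmem _), ⟨_, rfl⟩⟩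
    · simp [hℓ, h₀]
  choose Γ hΓ0 hΓ using hlift
  have hcont := hq.continuous_lift (T2Space.isSeparatedMap q)
    ⟨fun x ↦ expPt a (ℓ x), (continuous_expPt a).comp hℓc⟩ (g := fun x ↦ Γ x.2 x.1)
    (funext fun x ↦ hΓ x.2 x.1) (by simp only [hΓ0]; exact continuous_const)
    (fun s ↦ (Γ s).continuous)
  exact ⟨⟨fun s ↦ Γ s 1, hcont.comp (by fun_prop : Continuous fun s ↦ ((1 : I), s))⟩,
    fun s ↦ by simp [hΓ, hℓ]⟩

variable {F : C(expHalfPlane ρ, Y)}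

lemma exists_nhds_subset_range_lift (hq : IsLocalHomeomorph q)
    (hF : ∀ s, q (F s) = expPt a s) {y : Y} (hyD : q y ∈ sphericalDisk a ρ)
    (hy : y ∈ closure (range F)) :
    ∃ N ∈ 𝓝 y, ∀ z ∈ N, q z ∈ range (expPt a) → z ∈ range F := by
  obtain ⟨φ, hyφ, rfl⟩ := hq y
  obtain ⟨r, hr, hrN, hc⟩ := exists_isPathConnected_sphericalDisk a
    (inter_mem (φ.open_target.mem_nhds (φ.map_source hyφ))
      ((isOpen_sphericalDisk a ρ).mem_nhds hyD))
  have hN : φ.source ∩ φ ⁻¹' sphericalDisk (φ y) r ∈ 𝓝 y :=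
    inter_mem (φ.open_source.mem_nhds hyφ)
      ((φ.continuousAt hyφ).preimage_mem_nhds (sphericalDisk_mem_nhds _ hr))
  refine ⟨_, hN, fun z hz hzE ↦ ?_⟩
  obtain ⟨_, hs, s, rfl⟩ := mem_closure_iff_nhds.1 hy _ hN
  obtain ⟨γ, hγ⟩ := hc.joinedIn (φ (F s)) ⟨hs.2, s, (hF s).symm⟩ (φ z) ⟨hz.2, hzE⟩
  obtain ⟨Γ, hΓ0, hΓ⟩ := exists_path_lift_expPt (a := a) (s := s) γ.toContinuousMap
    (fun t ↦ (hγ t).2) (by simp [hF])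
  have hΓmem : ∀ t, Γ t ∈ expHalfPlane ρ := by
    intro t
    rw [← expPt_mem_sphericalDisk (a := a), hΓ]
    exact (hrN (hγ t).1).2
  have hlift : (fun t ↦ F ⟨Γ t, hΓmem t⟩) = fun t ↦ φ.symm (γ t) := by
    refine (T2Space.isSeparatedMap φ).eq_of_comp_eq hq.isLocallyInjective
      (F.continuous.comp (Γ.continuous.subtype_mk hΓmem))
      (φ.continuousOn_symm.comp_continuous γ.continuous fun t ↦ (hrN (hγ t).1).1)
      (funext fun t ↦ ?_) 0 ?_
    · simp only [Function.comp_apply, hF, hΓ]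
      rw [φ.right_inv (hrN (hγ t).1).1]
      rfl
    · simp only [hΓ0, γ.source]
      rw [φ.left_inv hs.1]
  exact ⟨_, (congrFun hlift 1).trans (by rw [γ.target, φ.left_inv hz.1])⟩

variable [PreconnectedSpace Y]

lemma denseRange_lift (hq : IsLocalHomeomorph q) (hρ : 0 < ρ)
    (hqD : ∀ y, q y ∈ sphericalDisk a ρ) (hF : ∀ s, q (F s) = expPt a s) : DenseRange F := by
  have hcl : IsClopen (closure (range F)) := by
    refine ⟨isClosed_closure, isOpen_iff_mem_nhds.2 fun y hy ↦ ?_⟩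
    obtain ⟨N, hN, hNF⟩ := exists_nhds_subset_range_lift hq hF (hqD y) hy
    refine mem_of_superset (interior_mem_nhds.2 hN) fun z hz ↦ ?_
    rw [mem_closure_iff_nhds]
    intro M hM
    have hMN := inter_mem hM (isOpen_interior.mem_nhds hz)
    obtain ⟨r, -, hrN, hc⟩ := exists_isPathConnected_sphericalDisk a
      (hq.isOpenMap.image_mem_nhds hMN)
    obtain ⟨t, ht, htE⟩ := hc.nonempty
    obtain ⟨x, ⟨hxM, hxN⟩, rfl⟩ := hrN ht
    exact ⟨x, hxM, hNF x (interior_subset hxN) htE⟩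
  obtain ⟨s, hs⟩ := nonempty_expHalfPlane hρ
  rw [DenseRange, dense_iff_closure_eq]
  exact hcl.eq_univ ⟨F ⟨s, hs⟩, subset_closure ⟨_, rfl⟩⟩

lemma mem_range_lift (hq : IsLocalHomeomorph q) (hρ : 0 < ρ)
    (hqD : ∀ y, q y ∈ sphericalDisk a ρ) (hF : ∀ s, q (F s) = expPt a s) {y : Y}
    (hy : q y ∈ range (expPt a)) : y ∈ range F := by
  obtain ⟨N, hN, hNF⟩ := exists_nhds_subset_range_lift hq hF (hqD y)
    (denseRange_lift hq hρ hqD hF y)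
  exact hNF y (mem_of_mem_nhds hN) hy

end Lift

section PathLift

variable {Y Z : Type*} [TopologicalSpace Y] [TopologicalSpace Z] {q : Y → Z} {γ : C(I, Z)}
  {y : Y} {f g : I → Y} {τ : I}

/-- `f` is a continuous lift along `q` of the restriction of the path `γ` to `s`, starting
at `y`. -/
structure IsPathLiftOn (q : Y → Z) (γ : C(I, Z)) (y : Y) (s : Set I) (f : I → Y) : Prop where
  continuousOn : ContinuousOn f s
  apply_zero : f 0 = y
  apply_eq : ∀ t ∈ s, q (f t) = γ t

lemma IsPathLiftOn.mono {s s' : Set I} (hf : IsPathLiftOn q γ y s f) (h : s' ⊆ s) :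
    IsPathLiftOn q γ y s' f :=
  ⟨hf.continuousOn.mono h, hf.apply_zero, fun t ht ↦ hf.apply_eq t (h ht)⟩

lemma IsPathLiftOn.exists_extend (hq : IsLocalHomeomorph q) (hf : IsPathLiftOn q γ y (Iic τ) f) :
    ∃ b, Iic b ∈ 𝓝 τ ∧ ∃ g, IsPathLiftOn q γ y (Iic b) g := by
  obtain ⟨φ, hφ, rfl⟩ := hq (f τ)
  have hfτ : φ (f τ) = γ τ := hf.apply_eq τ (mem_Iic.2 le_rfl)
  have hτ : γ τ ∈ φ.target := hfτ ▸ φ.map_source hφ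
  obtain ⟨b, hb, hbn, hbt⟩ := exists_Icc_mem_subset_of_mem_nhdsGE
    (nhdsWithin_le_nhds ((φ.open_target.preimage γ.continuous).mem_nhds hτ))
  refine ⟨b, ?_, fun t ↦ if t ≤ τ then f t else φ.symm (γ t), .if (fun s hs ↦ ?_) ?_ ?_, ?_,
    fun t ht ↦ ?_⟩
  · rw [← nhdsLE_sup_nhdsGE, mem_sup]
    exact ⟨mem_of_superset self_mem_nhdsWithin fun t ht ↦ le_trans ht hb,
      mem_of_superset hbn Icc_subset_Iic_self⟩
  · obtain rfl : s = τ := frontier_Iic_subset _ hs.2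
    rw [← hfτ, φ.left_inv hφ]
  · exact hf.continuousOn.mono fun s hs ↦
      (closure_le_eq continuous_id' continuous_const).subset hs.2
  · refine φ.continuousOn_symm.comp γ.continuous.continuousOn fun s hs ↦ hbt ⟨?_, hs.1⟩
    simp_rw [not_le] at hs
    exact closure_lt_subset_le (f := fun _ : I ↦ τ) continuous_const continuous_id hs.2
  · exact (if_pos bot_le).trans hf.apply_zero
  · split_ifs with h
    · exact hf.apply_eq t h
    · exact φ.right_inv (hbt ⟨(not_le.1 h).le, ht⟩)

lemma IsPathLiftOn.eqOn [T2Space Y] (hq : IsLocalHomeomorph q)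
    (hf : IsPathLiftOn q γ y (Iic τ) f) (hg : IsPathLiftOn q γ y (Iic τ) g) :
    EqOn f g (Iic τ) :=
  (T2Space.isSeparatedMap q).eqOn_of_comp_eqOn hq.isLocallyInjective isPreconnected_Iic
    hf.continuousOn hg.continuousOn
    (fun t ht ↦ (hf.apply_eq t ht).trans (hg.apply_eq t ht).symm) (mem_Iic.2 bot_le)
    (hf.apply_zero.trans hg.apply_zero.symm)

lemma exists_isPathLiftOn_Iio [T2Space Y] (hq : IsLocalHomeomorph q) (hτ : 0 < τ)
    (h : ∀ t < τ, ∃ f, IsPathLiftOn q γ y (Iic t) f) : ∃ f, IsPathLiftOn q γ y (Iio τ) f := by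
  have : Nonempty Y := ⟨y⟩
  choose! f hf using h
  refine ⟨fun t ↦ f t t, fun t ht ↦ ?_, (hf 0 hτ).apply_zero,
    fun t ht ↦ (hf t ht).apply_eq t (mem_Iic.2 le_rfl)⟩
  obtain ⟨u, htu, huτ⟩ := exists_between (mem_Iio.1 ht)
  have hcont : ContinuousAt (f u) t := (hf u huτ).continuousOn.continuousAt (Iic_mem_nhds htu)
  refine (hcont.congr ?_).continuousWithinAt
  filter_upwards [Iic_mem_nhds htu] with s hs
  exact IsPathLiftOn.eqOn hq ((hf u huτ).mono (Iic_subset_Iic.2 hs))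
    (hf s (lt_of_le_of_lt hs huτ)) (mem_Iic.2 le_rfl)

lemma IsPathLiftOn.exists_Iic_of_tendsto [T2Space Z] (hq : Continuous q) (hτ : 0 < τ)
    (hf : IsPathLiftOn q γ y (Iio τ) f) {p : Y} (hp : Tendsto f (𝓝[<] τ) (𝓝 p)) :
    ∃ g, IsPathLiftOn q γ y (Iic τ) g := by
  have : (𝓝[<] τ).NeBot := nhdsLT_neBot_of_exists_lt ⟨0, hτ⟩
  have hqp : q p = γ τ := tendsto_nhds_unique_of_eventuallyEq ((hq.tendsto p).comp hp)
    ((γ.continuous.tendsto τ).mono_left nhdsWithin_le_nhds)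
    (eventually_nhdsWithin_of_forall hf.apply_eq)
  have hext : Iio τ = Iic τ \ {τ} := by rw [Iic_sdiff_right]
  refine ⟨Function.update f τ p, ?_, ?_, fun t ht ↦ ?_⟩
  · refine continuousOn_update_iff.2 ⟨hext ▸ hf.continuousOn, fun _ ↦ hext ▸ hp⟩
  · rw [Function.update_of_ne hτ.ne, hf.apply_zero]
  · rcases (mem_Iic.1 ht).eq_or_lt with rfl | ht
    · rw [Function.update_self, hqp]
    · rw [Function.update_of_ne ht.ne, hf.apply_eq t ht]

theorem exists_path_lift_of_tendsto [T2Space Y] [T2Space Z] (hq : IsLocalHomeomorph q)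
    (hy : q y = γ 0)
    (hlim : ∀ τ f, 0 < τ → IsPathLiftOn q γ y (Iio τ) f → ∃ p, Tendsto f (𝓝[<] τ) (𝓝 p)) :
    ∃ Γ : C(I, Y), Γ 0 = y ∧ ∀ t, q (Γ t) = γ t := by
  set A : Set I := {τ | ∃ f, IsPathLiftOn q γ y (Iic τ) f}
  have hzero : (0 : I) ∈ A := by
    refine ⟨fun _ ↦ y, continuousOn_const, rfl, fun t ht ↦ ?_⟩
    obtain rfl : t = 0 := le_antisymm (mem_Iic.1 ht) bot_le
    exact hy
  have hlower : IsLowerSet A := fun t s hst ⟨f, hf⟩ ↦ ⟨f, hf.mono (Iic_subset_Iic.2 hst)⟩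
  have hopen : IsOpen A := isOpen_iff_mem_nhds.2 fun τ ⟨f, hf⟩ ↦ by
    obtain ⟨b, hb, hbA⟩ := hf.exists_extend hq
    exact mem_of_superset hb fun t ht ↦ hlower ht hbA
  have hclosed : IsClosed A := isClosed_of_closure_subset fun τ hτ ↦ by
    have hlt : ∀ t < τ, t ∈ A := fun t ht ↦ by
      obtain ⟨s, hts, hs⟩ := mem_closure_iff_nhds.1 hτ _ (Ioi_mem_nhds ht)
      exact hlower (le_of_lt hts) hs
    rcases (bot_le : (0 : I) ≤ τ).eq_or_lt with rfl | hτ0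
    · exact hzero
    obtain ⟨f, hf⟩ := exists_isPathLiftOn_Iio hq hτ0 hlt
    obtain ⟨p, hp⟩ := hlim τ f hτ0 hf
    exact hf.exists_Iic_of_tendsto hq.continuous hτ0 hp
  obtain ⟨f, hf⟩ : (1 : I) ∈ A := IsClopen.eq_univ ⟨hclosed, hopen⟩ ⟨0, hzero⟩ ▸ mem_univ _
  exact ⟨⟨f, continuousOn_univ.1 (hf.continuousOn.mono fun t _ ↦ mem_Iic.2 le_top)⟩, hf.apply_zero,
    fun t ↦ hf.apply_eq t (mem_Iic.2 le_top)⟩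

end PathLift

lemma isLocalHomeomorph_of_injectiveNear {X Y : Type*} [TopologicalSpace X] [TopologicalSpace Y]
    {f : X → Y} (hf : Continuous f) (hopen : IsOpenMap f) (hinj : ∀ x, InjectiveNear f x) :
    IsLocalHomeomorph f := by
  rw [isLocalHomeomorph_iff_isOpenEmbedding_restrict]
  intro x
  obtain ⟨N, hN, hNinj⟩ := hinj x
  exact ⟨interior N, interior_mem_nhds.2 hN, .of_continuous_injective_isOpenMap
    (hf.comp continuous_subtype_val) (injOn_iff_injective.1 (hNinj.mono interior_subset))
    (hopen.comp isOpen_interior.isOpenEmbedding_subtypeVal.isOpenMap)⟩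

section Germ

variable {S : Type*} [TopologicalSpace S] {Ψ : S → OnePoint ℂ} {e : S}

lemma exists_inverseGerm_of_tendsto {l : Filter S} [l.NeBot]
    (hl : ∀ N ∈ l, ∃ T ∈ l, T ⊆ N ∧ IsPreconnected T) (he : ∀ᶠ z in l, z ≠ e) {b : OnePoint ℂ}
    (hb : Tendsto Ψ l (𝓝 b)) :
    ∃ V : InverseGerm e Ψ, V.base = b ∧ ∀ ρ, V.nhd ρ ∈ l := by
  have hmem : ∀ ρ : Ioi (0 : ℝ), diskPreimage e Ψ b ρ ∈ l := fun ρ ↦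
    he.and (hb (sphericalDisk_mem_nhds b ρ.2))
  choose T hTl hT hTconn using fun ρ ↦ hl _ (hmem ρ)
  choose z hz using fun ρ ↦ Filter.nonempty_of_mem (hTl ρ)
  have hsub : ∀ ρ, T ρ ⊆ connectedComponentIn (diskPreimage e Ψ b ρ) (z ρ) := fun ρ ↦
    (hTconn ρ).subset_connectedComponentIn (hz ρ) (hT ρ)
  refine ⟨⟨b, fun ρ ↦ connectedComponentIn (diskPreimage e Ψ b ρ) (z ρ),
    fun ρ ↦ ⟨z ρ, hT ρ (hz ρ), rfl⟩, fun ρ₁ ρ₂ h ↦ ?_⟩, rfl,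
    fun ρ ↦ mem_of_superset (hTl ρ) (hsub ρ)⟩
  obtain ⟨x, hx₁, hx₂⟩ := Filter.nonempty_of_mem (inter_mem (hTl ρ₁) (hTl ρ₂))
  rw [connectedComponentIn_eq (hsub ρ₁ hx₁), connectedComponentIn_eq (hsub ρ₂ hx₂)]
  exact connectedComponentIn_mono _ (diskPreimage_mono _ h.le)

variable [ChartedSpace ℂ S] [IsManifold 𝓘(ℂ) 1 S] [ConnectedSpace S]

namespace IsTranscendentalMeromorphic

variable (hΨ : IsTranscendentalMeromorphic e Ψ)
include hΨ

lemma isLocalHomeomorph_restrict {X : Set S} (hX : IsOpen X) (heX : e ∉ X)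
    (hinj : ∀ x ∈ X, InjectiveNear Ψ x) : IsLocalHomeomorph fun x : X ↦ Ψ x := by
  have hne : ∀ x : X, (x : S) ≠ e := fun x ↦ ne_of_mem_of_not_mem x.2 heX
  refine isLocalHomeomorph_of_injectiveNear ?_ (IsOpenMap.of_nhds_le fun x ↦ ?_) fun x ↦ ?_
  · exact continuous_iff_continuousAt.2 fun x ↦
      (hΨ.continuousAt (hne x)).comp continuous_subtype_val.continuousAt
  · rw [← Function.comp_def Ψ, ← Filter.map_map, map_nhds_subtype_coe_eq_nhds x.2 (hX.mem_nhds x.2)]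
    exact (hΨ.meromorphic x (hne x)).nhds_le_map (hΨ.not_eventually_eq _ (hne x))
  · obtain ⟨N, hN, hNinj⟩ := hinj x x.2
    exact ⟨Subtype.val ⁻¹' N, continuous_subtype_val.continuousAt.preimage_mem_nhds hN,
      hNinj.comp Subtype.val_injective.injOn fun _ h ↦ h⟩

variable [T2Space S] {U : InverseGerm e Ψ} {ρ : Ioi (0 : ℝ)}

lemma exists_le_nhds_of_forall_isSingularity
    (hsep : ∀ V : InverseGerm e Ψ, V.IsSingularity → V ≠ U → ∃ ρ₂, Disjoint (U.nhd ρ) (V.nhd ρ₂))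
    {l : Filter S} [l.NeBot] (hl : ∀ N ∈ l, ∃ T ∈ l, T ⊆ N ∧ IsPreconnected T)
    (hlU : U.nhd ρ ∈ l) {b : OnePoint ℂ} (hb : Tendsto Ψ l (𝓝 b))
    (hbD : b ∈ sphericalDisk U.base ρ) (hbU : b ≠ U.base) : ∃ p ∈ U.nhd ρ, l ≤ 𝓝 p := by
  obtain ⟨V, rfl, hVl⟩ := exists_inverseGerm_of_tendsto hl
    (mem_of_superset hlU fun z hz ↦ (U.nhd_subset ρ hz).1) hb
  have hV : ¬ V.IsTranscendental := fun hV ↦ by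
    obtain ⟨r, hr⟩ := hsep V (Or.inr hV) fun h ↦ hbU (congrArg InverseGerm.base h)
    exact NeBot.ne ‹_› (empty_mem_iff_bot.1 (hr.inter_eq ▸ inter_mem hlU (hVl r)))
  obtain ⟨p, hp⟩ := nonempty_iff_ne_empty.2 hV
  rw [mem_iInter] at hp
  have hlp : l ≤ 𝓝 p := fun N hN ↦ by
    obtain ⟨r, hr⟩ := hΨ.exists_nhd_subset V hp hN
    exact mem_of_superset (hVl r) hr
  refine ⟨p, hΨ.mem_nhd_of_mem_closure U ?_ ⟨V.ne_of_forall_mem_nhd hp, ?_⟩, hlp⟩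
  · exact mem_closure_of_tendsto (f := id) hlp hlU
  · rwa [V.apply_eq_base_of_forall_mem_nhd hp]

lemma hasPathLifts_of_forall_isSingularity (hq : IsLocalHomeomorph fun x : U.nhd ρ ↦ Ψ x)
    (hsep : ∀ V : InverseGerm e Ψ, V.IsSingularity → V ≠ U → ∃ ρ₂, Disjoint (U.nhd ρ) (V.nhd ρ₂)) :
    HasPathLifts (fun x : U.nhd ρ ↦ Ψ x) U.base ρ := by
  intro γ hγ y hy
  refine exists_path_lift_of_tendsto hq hy fun τ f hτ hf ↦ ?_
  have : (𝓝[<] τ).NeBot := nhdsLT_neBot_of_exists_lt ⟨0, hτ⟩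
  set l : Filter S := map (fun t : I ↦ (f t : S)) (𝓝[<] τ)
  have hl : ∀ N ∈ l, ∃ T ∈ l, T ⊆ N ∧ IsPreconnected T := fun N hN ↦ by
    obtain ⟨t₀, ht₀, hsub⟩ := (mem_nhdsLT_iff_exists_Ioo_subset' hτ).1 hN
    exact ⟨_, image_mem_map (Ioo_mem_nhdsLT ht₀), image_subset_iff.2 hsub,
      isPreconnected_Ioo.image _ (continuous_subtype_val.comp_continuousOn
        (hf.continuousOn.mono Ioo_subset_Iio_self))⟩
  have hΨl : Tendsto Ψ l (𝓝 (γ τ)) := tendsto_map'_iff.2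
    (((γ.continuous.tendsto τ).mono_left nhdsWithin_le_nhds).congr'
      (eventually_nhdsWithin_of_forall fun t ht ↦ (hf.apply_eq t ht).symm))
  obtain ⟨p, hp, hle⟩ := hΨ.exists_le_nhds_of_forall_isSingularity hsep hl
    (eventually_map.2 (.of_forall fun t ↦ (f t).2)) hΨl (hγ τ).1 (mem_range_expPt.1 (hγ τ).2).2
  exact ⟨⟨p, hp⟩, tendsto_subtype_rng.2 hle⟩

end IsTranscendentalMeromorphic

end Germ

section Lift

variable {Y : Type*} [TopologicalSpace Y] [T2Space Y] {q : Y → OnePoint ℂ} {a : OnePoint ℂ}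
  {ρ : ℝ} {F : C(expHalfPlane ρ, Y)}

lemma lift_eq_of_eq_add (hq : IsLocalHomeomorph q) (hF : ∀ s, q (F s) = expPt a s) {n : ℤ}
    {s s' z z' : expHalfPlane ρ} (hs : (s' : ℂ) = s + n * (2 * Real.pi * Complex.I))
    (h : F s' = F s) (hz : (z' : ℂ) = z + n * (2 * Real.pi * Complex.I)) : F z' = F z := by
  have hmem : ∀ w : expHalfPlane ρ, (w : ℂ) + n * (2 * Real.pi * Complex.I) ∈ expHalfPlane ρ :=
    fun w ↦ expHalfPlane_of_re_le w.2 (by simp)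
  have heq : (fun w : expHalfPlane ρ ↦ F ⟨_, hmem w⟩) = F := by
    refine (T2Space.isSeparatedMap q).eq_of_comp_eq hq.isLocallyInjective
      (F.continuous.comp (Continuous.subtype_mk (by fun_prop) hmem)) F.continuous
      (funext fun w ↦ ?_) s ((congrArg F (Subtype.ext hs.symm)).trans h)
    simp only [Function.comp_apply, hF]
    exact expPt_eq_expPt_iff.2 ⟨n, rfl⟩
  exact (congrArg F (Subtype.ext hz)).trans (congrFun heq z)

lemma exists_period_lift (hq : IsLocalHomeomorph q) (hF : ∀ s, q (F s) = expPt a s)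
    (hinj : ¬ Function.Injective F) :
    ∃ n : ℤ, n ≠ 0 ∧ ∀ z z' : expHalfPlane ρ,
      (z' : ℂ) = z + n * (2 * Real.pi * Complex.I) → F z' = F z := by
  obtain ⟨s', s, h, hne⟩ := Function.not_injective_iff.1 hinj
  obtain ⟨n, hn⟩ := expPt_eq_expPt_iff.1 ((hF s').symm.trans ((congrArg q h).trans (hF s)))
  refine ⟨n, ?_, fun z z' ↦ lift_eq_of_eq_add hq hF hn h⟩
  rintro rfl
  exact hne (Subtype.ext (by simpa using hn))

lemma isCompact_setOf_sphericalDist_eq (hq : IsLocalHomeomorph q)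
    (hF : ∀ s, q (F s) = expPt a s) (hsurj : Function.Surjective F)
    (hinj : ¬ Function.Injective F) {r : ℝ} (hr : 0 < r) (hrρ : r < ρ) (hrπ : r < Real.pi) :
    IsCompact {y | sphericalDist (q y) a = r} := by
  obtain ⟨n, hn, hper⟩ := exists_period_lift hq hF hinj
  set x := Real.log (Real.tan (r / 2))
  have hx : 2 * Real.arctan (Real.exp x) = r := by
    rw [Real.exp_log (tan_half_pos hr hrπ), Real.arctan_tan (by linarith) (by linarith)]
    ring
  have hmem : ∀ t : ℝ, (x : ℂ) + t * Complex.I ∈ expHalfPlane ρ := fun t ↦ by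
    change 2 * Real.arctan (Real.exp ((x : ℂ) + t * Complex.I).re) < ρ
    simpa [hx] using hrρ
  have hrange : {y | sphericalDist (q y) a = r} = range fun t : ℝ ↦ F ⟨_, hmem t⟩ := by
    refine Subset.antisymm (fun y hy ↦ ?_) (range_subset_iff.2 fun t ↦ ?_)
    · obtain ⟨s, rfl⟩ := hsurj y
      rw [mem_ofPred_eq, hF, sphericalDist_expPt, ← hx] at hy
      have hre : x = (s : ℂ).re := by
        rwa [mul_right_inj' two_ne_zero, Real.arctan_inj, Real.exp_eq_exp, eq_comm] at hy
      refine ⟨(s : ℂ).im, congrArg F (Subtype.ext ?_)⟩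
      change (x : ℂ) + (s : ℂ).im * Complex.I = s
      rw [hre, Complex.re_add_im]
    · rw [mem_ofPred_eq, hF, sphericalDist_expPt, ← hx]
      simp
  rw [hrange]
  refine Function.Periodic.compact_of_continuous (c := n * (2 * Real.pi)) (fun t ↦ ?_)
    (by simp [hn]) (F.continuous.comp (Continuous.subtype_mk (by fun_prop) hmem))
  refine hper _ _ ?_
  push_cast
  ring

end Lift

section Section

variable {X E ι : Type*} [TopologicalSpace X] [TopologicalSpace E] [TopologicalSpace ι]

lemma exists_section_leftInvOn_of_isEvenlyCovered {f : E → X} {x : X} (h : IsEvenlyCovered f x ι) :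
    ∃ N ∈ 𝓝 x, ∀ T, IsPreconnected T → T.Nonempty → MapsTo f T N →
      ∃ g : C(N, E), (∀ y, f (g y) = y) ∧ ∀ z ∈ T, ∀ hz : f z ∈ N, g ⟨f z, hz⟩ = z := by
  obtain ⟨hι, N, hxN, hN, -, H, hH⟩ := h
  refine ⟨N, hN.mem_nhds hxN, fun T hT hTne hTN ↦ ?_⟩
  obtain ⟨z₀, hz₀⟩ := hTne
  have hconst : ∀ z (hz : z ∈ T), (H ⟨z, hTN hz⟩).2 = (H ⟨z₀, hTN hz₀⟩).2 := by
    have := isPreconnected_iff_preconnectedSpace.1 hT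
    exact fun z hz ↦ PreconnectedSpace.constant inferInstance
      (f := fun z : T ↦ (H ⟨z, hTN z.2⟩).2) (by fun_prop) (x := ⟨z, hz⟩) (y := ⟨z₀, hz₀⟩)
  refine ⟨⟨fun y ↦ H.symm (y, (H ⟨z₀, hTN hz₀⟩).2), by fun_prop⟩, fun y ↦ ?_, fun z hz hzN ↦ ?_⟩
  · simp [← hH]
  · have hHz : H ⟨z, hzN⟩ = (⟨f z, hzN⟩, (H ⟨z₀, hTN hz₀⟩).2) :=
      Prod.ext (Subtype.ext (hH _)) (hconst z hz)
    simp [← hHz]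

end Section

lemma isLocalHomeomorph_coe_of_isCoveringMap {X Y : Type*} [TopologicalSpace X]
    [TopologicalSpace Y] {s : Set Y} (hs : IsOpen s) {f : X → s} (hf : IsCoveringMap f) :
    IsLocalHomeomorph fun x ↦ (f x : Y) :=
  hs.isOpenEmbedding_subtypeVal.isLocalHomeomorph.comp hf.isLocalHomeomorph

lemma injectiveNear_of_isLocalHomeomorph_restrict {X Y : Type*} [TopologicalSpace X]
    [TopologicalSpace Y] {f : X → Y} {s : Set X} (hs : IsOpen s)
    (hf : IsLocalHomeomorph fun x : s ↦ f x) {x : X} (hx : x ∈ s) : InjectiveNear f x := by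
  obtain ⟨φ, hxφ, hφ⟩ := hf ⟨x, hx⟩
  refine ⟨Subtype.val '' φ.source, hs.isOpenMap_subtype_val.image_mem_nhds
    (φ.open_source.mem_nhds hxφ), ?_⟩
  have hinj : InjOn (fun x : s ↦ f x) φ.source := hφ ▸ φ.injOn
  rintro _ ⟨y, hy, rfl⟩ _ ⟨z, hz, rfl⟩ hyz
  rw [hinj hy hz hyz]

lemma hasPathLifts_of_isCoveringMap {Y : Type*} [TopologicalSpace Y] {a : OnePoint ℂ} {ρ : ℝ}
    {f : Y → (sphericalDisk a ρ \ {a} : Set (OnePoint ℂ))} (hf : IsCoveringMap f) :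
    HasPathLifts (fun y ↦ (f y : OnePoint ℂ)) a ρ := by
  intro γ hγ y hy
  have hmem : ∀ t, γ t ∈ sphericalDisk a ρ \ {a} := fun t ↦
    ⟨(hγ t).1, (mem_range_expPt.1 (hγ t).2).2⟩
  obtain ⟨Γ, hΓ, hΓ0⟩ := hf.exists_path_lifts
    ⟨fun t ↦ ⟨γ t, hmem t⟩, γ.continuous.subtype_mk hmem⟩ y (Subtype.ext hy.symm)
  exact ⟨Γ, hΓ0, fun t ↦ congrArg Subtype.val (congrFun hΓ t)⟩

namespace InverseGerm

variable {S : Type*} [TopologicalSpace S] {Ψ : S → OnePoint ℂ} {e : S} {U V : InverseGerm e Ψ}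
  {ρ : Ioi (0 : ℝ)}

lemma sphericalDist_base_le_of_forall_not_disjoint
    (hmeet : ∀ ρ₂, ¬ Disjoint (U.nhd ρ) (V.nhd ρ₂)) : sphericalDist V.base U.base ≤ ρ := by
  by_contra hlt
  obtain ⟨r, hr, -, hrN⟩ := exists_sphericalDisk_subset
    ((isClosed_sphericalDist_le U.base ρ).isOpen_compl.mem_nhds hlt)
  obtain ⟨y, hyU, hyV⟩ := not_disjoint_iff.1 (hmeet ⟨r, mem_Ioi.2 hr⟩)
  have hy : sphericalDist (Ψ y) U.base < ρ := (U.nhd_subset ρ hyU).2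
  exact hrN (V.nhd_subset _ hyV).2 hy.le

lemma nhd_subset_nhd_of_not_disjoint {r : Ioi (0 : ℝ)}
    (hr : sphericalDisk V.base r ⊆ sphericalDisk U.base ρ)
    (hmeet : ¬ Disjoint (U.nhd ρ) (V.nhd r)) : V.nhd r ⊆ U.nhd ρ := by
  obtain ⟨x, hxU, hxV⟩ := not_disjoint_iff.1 hmeet
  exact U.subset_nhd (V.isPreconnected_nhd r)
    (fun z hz ↦ ⟨(V.nhd_subset r hz).1, hr (V.nhd_subset r hz).2⟩) ⟨x, hxV, hxU⟩

lemma exists_mem_of_isCoveringMap (h : MapsTo Ψ (U.nhd ρ) (sphericalDisk U.base ρ \ {U.base}))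
    (hcov : IsCoveringMap h.restrict) (hb : V.base ∈ sphericalDisk U.base ρ \ {U.base})
    (hmeet : ∀ ρ₂, ¬ Disjoint (U.nhd ρ) (V.nhd ρ₂)) : ∃ x ∈ U.nhd ρ, ∀ ρ₂, x ∈ V.nhd ρ₂ := by
  have hopen : IsOpen (sphericalDisk U.base ρ \ {U.base}) :=
    (isOpen_sphericalDisk _ _).sdiff isClosed_singleton
  obtain ⟨N, hN, hsec⟩ := exists_section_leftInvOn_of_isEvenlyCovered
    ((hcov ⟨V.base, hb⟩).subtypeVal_comp _ hopen)
  obtain ⟨r, hr, hrπ, hrN⟩ := exists_sphericalDisk_subset (inter_mem hN (hopen.mem_nhds hb))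
  lift r to Ioi (0 : ℝ) using hr
  have hVU : V.nhd r ⊆ U.nhd ρ :=
    nhd_subset_nhd_of_not_disjoint (fun t ht ↦ (hrN ht).2.1) (hmeet r)
  have hVr : Subtype.val '' (Subtype.val ⁻¹' V.nhd r : Set (U.nhd ρ)) = V.nhd r :=
    Subtype.image_preimage_coe .. ▸ inter_eq_right.2 hVU
  obtain ⟨g, hg, hgV⟩ := hsec (Subtype.val ⁻¹' V.nhd r)
    (IsInducing.subtypeVal.isPreconnected_image.1 (hVr.symm ▸ V.isPreconnected_nhd r))
    (image_nonempty.1 (hVr.symm ▸ V.nonempty_nhd r)) fun z hz ↦ (hrN (V.nhd_subset r hz).2).1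
  refine ⟨g ⟨V.base, mem_of_mem_nhds hN⟩, (g _).2, fun ρ₂ ↦ ?_⟩
  set δ := min ρ₂ r
  have hδr : (δ : ℝ) ≤ r := min_le_right ρ₂ r
  have hδN : ∀ t ∈ sphericalDisk V.base δ, t ∈ N := fun t ht ↦
    (hrN (sphericalDisk_mono _ hδr ht)).1
  have : PreconnectedSpace (sphericalDisk V.base δ) := isPreconnected_iff_preconnectedSpace.1
    (isPreconnected_sphericalDisk δ.2 (hδr.trans_lt hrπ))
  have hsheet : IsPreconnected (range fun t : sphericalDisk V.base δ ↦ (g ⟨t, hδN t t.2⟩ : S)) :=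
    isPreconnected_range (by fun_prop)
  obtain ⟨z, hz⟩ := V.nonempty_nhd δ
  have hzr := V.monotone_nhd (min_le_right ρ₂ r) hz
  refine V.monotone_nhd (min_le_left ρ₂ r) (V.subset_nhd hsheet ?_ ⟨z, ⟨⟨Ψ z, ?_⟩, ?_⟩, hz⟩
    ⟨⟨V.base, center_mem_sphericalDisk _ δ.2⟩, rfl⟩)
  · rintro _ ⟨t, rfl⟩
    exact ⟨(U.nhd_subset ρ (g _).2).1, mem_of_eq_of_mem (hg ⟨t, hδN t t.2⟩) t.2⟩
  · exact (V.nhd_subset δ hz).2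
  · exact congrArg Subtype.val (hgV ⟨z, hVU hzr⟩ hzr _)

end InverseGerm

namespace IsTranscendentalMeromorphic

variable {S : Type*} [TopologicalSpace S] [ChartedSpace ℂ S] [IsManifold 𝓘(ℂ) 1 S] [T2Space S]
  {Ψ : S → OnePoint ℂ} {e : S} (hΨ : IsTranscendentalMeromorphic e Ψ) {U : InverseGerm e Ψ}
  {ρ : Ioi (0 : ℝ)}
include hΨ

lemma mem_closure_setOf_sphericalDist_eq (hacc : U.AccumulatesAtEssential) {r : Ioi (0 : ℝ)}
    (hrρ : r < ρ) (hrπ : (r : ℝ) < Real.pi) :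
    e ∈ closure {x ∈ U.nhd ρ | sphericalDist (Ψ x) U.base = r} := by
  by_contra he
  obtain ⟨W, hWN, hWo, heW, hWc⟩ := exists_isPreconnected_diff_singleton
    (isClosed_closure.isOpen_compl.mem_nhds he)
  have hWU : W \ {e} ⊆ U.nhd r := by
    refine hWc.subset_of_closure_inter_subset (hΨ.isOpen_nhd U r) ?_ ?_
    · obtain ⟨x, hxW, hxU⟩ := mem_closure_iff.1 (hacc r) W hWo heW
      exact ⟨x, ⟨hxW, (U.nhd_subset r hxU).1⟩, hxU⟩
    · rintro x ⟨hx, hxW, hxe⟩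
      have hle := hΨ.sphericalDist_le_of_mem_closure U hxe hx
      have hxU : x ∈ U.nhd ρ := hΨ.mem_nhd_of_mem_closure U
        (closure_mono (U.monotone_nhd hrρ.le) hx) ⟨hxe, hle.trans_lt hrρ⟩
      exact hΨ.mem_nhd_of_mem_closure U hx
        ⟨hxe, hle.lt_of_ne fun heq ↦ hWN hxW (subset_closure ⟨hxU, heq⟩)⟩
  refine hΨ.not_eventually_mem_sphericalDisk (a := U.base) r.2 hrπ (eventually_nhdsWithin_iff.2 ?_)
  filter_upwards [hWo.mem_nhds heW] with z hz hze
  exact (U.nhd_subset r (hWU ⟨hz, hze⟩)).2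

variable [ConnectedSpace S]

section Lift

variable (hq : IsLocalHomeomorph fun x : U.nhd ρ ↦ Ψ x)
  (hpl : HasPathLifts (fun x : U.nhd ρ ↦ Ψ x) U.base ρ)
include hq hpl

lemma mem_nhd_of_mem_sphericalDisk_diff {δ : Ioi (0 : ℝ)} (hδρ : δ ≤ ρ) (hδπ : (δ : ℝ) ≤ Real.pi)
    {x : S} (hx : x ∈ U.nhd ρ) (hxD : Ψ x ∈ sphericalDisk U.base δ \ {U.base}) : x ∈ U.nhd δ := by
  have hqD : ∀ y : U.nhd ρ, Ψ y ∈ sphericalDisk U.base ρ := fun y ↦ (U.nhd_subset ρ y.2).2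
  have : Nonempty (U.nhd ρ) := ⟨⟨x, hx⟩⟩
  obtain ⟨F, hF⟩ := hpl.exists_expPt_lift hq hqD
  have hδ : ∀ s ∈ expHalfPlane δ, s ∈ expHalfPlane ρ := expHalfPlane_mono hδρ
  set Z : Set S := range fun s : expHalfPlane δ ↦ (F ⟨s, hδ s s.2⟩ : S)
  have hmemZ : ∀ y ∈ U.nhd ρ, Ψ y ∈ sphericalDisk U.base δ \ {U.base} → y ∈ Z := by
    intro y hy hyD
    obtain ⟨s, hs⟩ := mem_range_lift hq ρ.2 hqD hF (y := ⟨y, hy⟩)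
      (sphericalDisk_diff_subset_range_expPt hδπ hyD)
    have hsδ : expPt U.base s ∈ sphericalDisk U.base δ := by
      rw [← hF, hs]
      exact hyD.1
    exact ⟨⟨s, expPt_mem_sphericalDisk.1 hsδ⟩, congrArg Subtype.val hs⟩
  have hZD : Z ⊆ diskPreimage e Ψ U.base δ := by
    rintro _ ⟨s, rfl⟩
    exact ⟨(U.nhd_subset ρ (F _).2).1, (hF _).symm ▸ expPt_mem_sphericalDisk.2 s.2⟩
  obtain ⟨z, hz⟩ := U.nonempty_nhd δ
  obtain ⟨y, hyb, hy⟩ := ((not_eventually.1 (hΨ.not_eventually_eq U.base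
    (U.nhd_subset δ hz).1)).and_eventually ((hΨ.isOpen_nhd U δ).mem_nhds hz)).exists
  exact U.subset_nhd (isPreconnected_range (by fun_prop)) hZD
    ⟨y, hmemZ y (U.monotone_nhd hδρ hy) ⟨(U.nhd_subset δ hy).2, hyb⟩, hy⟩ (hmemZ x hx hxD)

lemma ne_base_of_isTranscendental (hU : U.IsTranscendental) (hρ : (ρ : ℝ) ≤ Real.pi) {x : S}
    (hx : x ∈ U.nhd ρ) : Ψ x ≠ U.base := by
  intro hxb
  have hxe := (U.nhd_subset ρ hx).1
  suffices hmem : ∀ δ, x ∈ U.nhd δ from notMem_empty x (hU ▸ mem_iInter.2 hmem)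
  intro δ'
  set δ : Ioi (0 : ℝ) := min δ' ρ
  have hδρ : δ ≤ ρ := min_le_right _ _
  have hxD : Ψ x ∈ sphericalDisk U.base δ := hxb ▸ center_mem_sphericalDisk _ δ.2
  have hnear : ∀ᶠ y in 𝓝 x, y ∈ U.nhd ρ ∧ Ψ y ∈ sphericalDisk U.base δ :=
    inter_mem ((hΨ.isOpen_nhd U ρ).mem_nhds hx)
      ((hΨ.continuousAt hxe).preimage_mem_nhds ((isOpen_sphericalDisk _ _).mem_nhds hxD))
  have hfreq : ∃ᶠ y in 𝓝 x, y ∈ U.nhd δ :=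
    ((not_eventually.1 (hΨ.not_eventually_eq U.base hxe)).and_eventually hnear).mono fun y hy ↦
      hΨ.mem_nhd_of_mem_sphericalDisk_diff hq hpl hδρ ((Subtype.coe_le_coe.2 hδρ).trans hρ) hy.2.1
        ⟨hy.2.2, hy.1⟩
  exact U.monotone_nhd (min_le_left δ' ρ)
    (hΨ.mem_nhd_of_mem_closure U (mem_closure_iff_frequently.2 hfreq) ⟨hxe, hxD⟩)

lemma exists_bijective_lift (hU : U.IsTranscendental) (hacc : U.AccumulatesAtEssential)
    (hρ : (ρ : ℝ) ≤ Real.pi) : ∃ F : C(expHalfPlane ρ, U.nhd ρ), Function.Bijective F ∧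
      ∀ s, Ψ (F s) = expPt U.base s := by
  have hqD : ∀ y : U.nhd ρ, Ψ y ∈ sphericalDisk U.base ρ := fun y ↦ (U.nhd_subset ρ y.2).2
  have := (U.nonempty_nhd ρ).to_subtype
  obtain ⟨F, hF⟩ := hpl.exists_expPt_lift hq hqD
  have hsurj : Function.Surjective F := fun x ↦ mem_range_lift hq ρ.2 hqD hF
    (sphericalDisk_diff_subset_range_expPt hρ
      ⟨hqD x, hΨ.ne_base_of_isTranscendental hq hpl hU hρ x.2⟩)
  refine ⟨F, ⟨?_, hsurj⟩, hF⟩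
  by_contra hinj
  obtain ⟨r, hr, hrρ⟩ := exists_between (mem_Ioi.1 ρ.2)
  lift r to Ioi (0 : ℝ) using hr
  have hrπ := hrρ.trans_le hρ
  have hcpt := (isCompact_setOf_sphericalDist_eq hq hF hsurj hinj r.2 hrρ hrπ).image
    continuous_subtype_val
  have hsub : {x ∈ U.nhd ρ | sphericalDist (Ψ x) U.base = r} ⊆
      Subtype.val '' {x : U.nhd ρ | sphericalDist (Ψ x) U.base = r} :=
    fun x hx ↦ ⟨⟨x, hx.1⟩, hx.2, rfl⟩
  obtain ⟨x, -, hx⟩ := closure_minimal hsub hcpt.isClosed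
    (hΨ.mem_closure_setOf_sphericalDist_eq hacc hrρ hrπ)
  exact (U.nhd_subset ρ x.2).1 hx

lemma isLogarithmic_of_hasPathLifts (hU : U.IsTranscendental) (hacc : U.AccumulatesAtEssential)
    (hρ : (ρ : ℝ) ≤ Real.pi) : U.IsLogarithmic := by
  obtain ⟨F, hbij, hF⟩ := hΨ.exists_bijective_lift hq hpl hU hacc hρ
  have hloc : IsLocalHomeomorph F := by
    have hcomp : (fun x : U.nhd ρ ↦ Ψ x) ∘ F = expPt U.base ∘ Subtype.val := funext hF
    refine .of_comp (g := fun x : U.nhd ρ ↦ Ψ x) (hcomp ▸ ?_) hq F.continuous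
    exact (isLocalHomeomorph_expPt _).comp
      (isOpen_expHalfPlane ρ).isOpenEmbedding_subtypeVal.isLocalHomeomorph
  set Φ : expHalfPlane ρ ≃ₜ U.nhd ρ := hloc.toHomeomorphOfBijective hbij
  have hmaps : MapsTo Ψ (U.nhd ρ) (sphericalDisk U.base ρ \ {U.base}) := fun x hx ↦
    ⟨(U.nhd_subset ρ hx).2, hΨ.ne_base_of_isTranscendental hq hpl hU hρ hx⟩
  refine ⟨hU, ρ, hmaps, ?_, ?_⟩
  · have hpre : expPt U.base ⁻¹' (sphericalDisk U.base ρ \ {U.base}) = expHalfPlane ρ := by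
      ext s
      exact ⟨fun hs ↦ expPt_mem_sphericalDisk.1 hs.1,
        fun hs ↦ ⟨expPt_mem_sphericalDisk.2 hs, expPt_ne _ _⟩⟩
    have hcov := (((isCoveringMapOn_expPt U.base).mono
      (sphericalDisk_diff_subset_range_expPt hρ)).isCoveringMap_restrictPreimage.comp_homeomorph
        (Homeomorph.setCongr hpre.symm)).comp_homeomorph Φ.symm
    convert hcov using 1
    funext x
    obtain ⟨s, rfl⟩ := Φ.surjective x
    refine Subtype.ext ((hF s).trans ?_)
    simp only [Function.comp_apply, Φ.symm_apply_apply]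
    rfl
  · have : ContractibleSpace (expHalfPlane ρ) :=
      (convex_expHalfPlane ρ).contractibleSpace (nonempty_expHalfPlane ρ.2)
    have : ContractibleSpace (U.nhd ρ) := Φ.symm.contractibleSpace
    infer_instance

end Lift

lemma injectiveNear_of_forall_isSingularity (hU : U.IsTranscendental)
    (hsep : ∀ V : InverseGerm e Ψ, V.IsSingularity → V ≠ U → ∃ ρ₂, Disjoint (U.nhd ρ) (V.nhd ρ₂))
    {x : S} (hx : x ∈ U.nhd ρ) : InjectiveNear Ψ x := by
  by_contra hninj
  have hxe := (U.nhd_subset ρ hx).1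
  have hmem := InverseGerm.mem_nhd_ofPoint (Ψ := Ψ) hxe
  have hinter := hΨ.iInter_nhd_eq_singleton _ hmem
  obtain ⟨ρ₂, hdisj⟩ := hsep (.ofPoint Ψ hxe)
    (Or.inl ⟨x, hinter, isCriticalPt_iff.2 ⟨hΨ.meromorphic x hxe, hninj⟩⟩) fun h ↦
      singleton_ne_empty x (hinter.symm.trans (h ▸ hU))
  exact disjoint_left.1 hdisj hx (hmem ρ₂)

theorem isLogarithmic_of_isSeparate (hU : U.IsTranscendental) (hacc : U.AccumulatesAtEssential)
    (hsep : U.IsSeparate) : U.IsLogarithmic := by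
  obtain ⟨ρ₁, hρ₁⟩ := hsep
  set ρ : Ioi (0 : ℝ) := min ρ₁ ⟨Real.pi, mem_Ioi.2 Real.pi_pos⟩
  have hρ : ρ ≤ ⟨Real.pi, mem_Ioi.2 Real.pi_pos⟩ := min_le_right _ _
  have hsep : ∀ V : InverseGerm e Ψ, V.IsSingularity → V ≠ U →
      ∃ ρ₂, Disjoint (U.nhd ρ) (V.nhd ρ₂) := fun V hV hVU ↦
    (hρ₁ V hV hVU).imp fun _ h ↦ h.mono_left (U.monotone_nhd (min_le_left _ _))
  have hq := hΨ.isLocalHomeomorph_restrict (hΨ.isOpen_nhd U ρ)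
    (fun he ↦ (U.nhd_subset ρ he).1 rfl) fun x ↦ hΨ.injectiveNear_of_forall_isSingularity hU hsep
  exact hΨ.isLogarithmic_of_hasPathLifts hq (hΨ.hasPathLifts_of_forall_isSingularity hq hsep)
    hU hacc hρ

lemma eq_of_hasPathLifts (hq : IsLocalHomeomorph fun x : U.nhd ρ ↦ Ψ x)
    (hpl : HasPathLifts (fun x : U.nhd ρ ↦ Ψ x) U.base ρ) (hne : ∀ x ∈ U.nhd ρ, Ψ x ≠ U.base)
    {V : InverseGerm e Ψ} (hb : V.base = U.base)
    (hmeet : ∀ ρ₂, ¬ Disjoint (U.nhd ρ) (V.nhd ρ₂)) : V = U := by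
  refine InverseGerm.eq_of_forall_inter_nonempty hb fun δ' ↦ ?_
  set δ : Ioi (0 : ℝ) := min δ' (min ρ ⟨Real.pi, mem_Ioi.2 Real.pi_pos⟩)
  have hδδ' : δ ≤ δ' := min_le_left _ _
  have hδρ : δ ≤ ρ := (min_le_right _ _).trans (min_le_left _ _)
  have hδπ : δ ≤ ⟨Real.pi, mem_Ioi.2 Real.pi_pos⟩ := (min_le_right _ _).trans (min_le_right _ _)
  obtain ⟨x, hx⟩ := V.nonempty_nhd δ
  have hxU : x ∈ U.nhd ρ := InverseGerm.nhd_subset_nhd_of_not_disjoint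
    (hb ▸ sphericalDisk_mono _ hδρ) (hmeet δ) hx
  exact ⟨x, V.monotone_nhd hδδ' hx, U.monotone_nhd hδδ' (hΨ.mem_nhd_of_mem_sphericalDisk_diff hq
    hpl hδρ hδπ hxU ⟨hb ▸ (V.nhd_subset δ hx).2, hne x hxU⟩)⟩

theorem isSeparate_of_isLogarithmic (hU : U.IsLogarithmic) : U.IsSeparate := by
  obtain ⟨-, ρ, h, hcov, -⟩ := hU
  have hq : IsLocalHomeomorph fun x : U.nhd ρ ↦ Ψ x := isLocalHomeomorph_coe_of_isCoveringMap
    ((isOpen_sphericalDisk _ _).sdiff isClosed_singleton) hcov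
  have hlt : (ρ / 2 : ℝ) < ρ := half_lt_self ρ.2
  refine ⟨⟨ρ / 2, mem_Ioi.2 (half_pos ρ.2)⟩, fun V hV hVU ↦ ?_⟩
  by_contra! hmeet
  have hbD : V.base ∈ sphericalDisk U.base ρ :=
    (InverseGerm.sphericalDist_base_le_of_forall_not_disjoint hmeet).trans_lt hlt
  have hmeetρ : ∀ ρ₂, ¬ Disjoint (U.nhd ρ) (V.nhd ρ₂) := fun ρ₂ hdisj ↦
    hmeet ρ₂ (hdisj.mono_left (U.monotone_nhd hlt.le))
  by_cases hb : V.base = U.base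
  · exact hVU (hΨ.eq_of_hasPathLifts hq (hasPathLifts_of_isCoveringMap hcov)
      (fun x hx ↦ (h hx).2) hb hmeetρ)
  · obtain ⟨x, hxU, hx⟩ := InverseGerm.exists_mem_of_isCoveringMap h hcov ⟨hbD, hb⟩ hmeetρ
    exact (isCriticalPt_iff.1 (hV.isCriticalPt hx)).2
      (injectiveNear_of_isLocalHomeomorph_restrict (hΨ.isOpen_nhd U ρ) hq hxU)

end IsTranscendentalMeromorphic

end

theorem theorem1 {S : Type*} [TopologicalSpace S] [T2Space S] [ConnectedSpace S]
    [ChartedSpace ℂ S] [IsManifold 𝓘(ℂ) 1 S] (e : S) (Ψ : S → OnePoint ℂ)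
    (hΨ : IsTranscendentalMeromorphic e Ψ) (U : InverseGerm e Ψ) (hU : U.IsSingularity)
    (he : U.IsTranscendental → U.AccumulatesAtEssential) :
    U.IsSeparate ↔ U.IsAlgebraic ∨ U.IsLogarithmic := by
  constructor
  · exact fun hsep ↦ hU.imp id fun hT ↦ hΨ.isLogarithmic_of_isSeparate hT (he hT) hsep
  · rintro (h | h)
    · exact hΨ.isSeparate_of_isAlgebraic h
    · exact hΨ.isSeparate_of_isLogarithmic h
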